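/- Let $T>0$ and let $(W^1_t,W^2_t)_{t\in[0,T]}$ be a two-dimensional standard Brownian motion, let $V_0$ be a centred normal random variable (possibly degenerate) independent of $(W^1,W^2)$, and let $\sigma\in L^2([0,T])$ be deterministic. Let $V$ be the process with continuous paths given by $$V_t=V_0+\int_0^t\sigma_s\,dW^1_s,\qquad 0\le t\le T$$ (a Wiener integral). Assume that $\mathrm{Var}(V_T)=T$ (in particular, $\mathrm{Var}(V_T)=1$ when $T=1$) and that $$\int_0^t\frac{ds}{|\mathrm{Var}(V_s)-s|}<\infty\qquad\text{for all }0\le t<T,$$ where $1/0=\infty$. Then the equation $$B_t=W^2_t+\int_0^t\frac{V_s-B_s}{\mathrm{Var}(V_s)-s}\,ds,\qquad 0\le t\le T,$$ holding almost surely for all $t$ simultaneously, where the integral is an absolutely convergent Lebesgue integral for $t<T$ and $\int_0^T$ means the limit of $\int_0^t$ as $t\uparrow T$, has a solution $B=(B_t)_{t\in[0,T]}$, which is unique up to indistinguishability. This process $B$ is a standard Brownian motion on $[0,T]$, and $B_T=V_T$ almost surely. -/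

import Mathlib

open MeasureTheory ProbabilityTheory Filter Topology Set

/-- `X` is a standard Brownian motion on the time interval `[0, T]` under `P`: its
finite-dimensional laws at times of `[0, T]` are those of the standard Brownian motion, and almost
all of its paths are continuous on `[0, T]`. The values of `X` outside of `[0, T]` play no role. -/
structure IsBrownianOn {Ω : Type*} [MeasurableSpace Ω] (P : Measure Ω) (T : ℝ) (X : ℝ → Ω → ℝ) :
    Prop where
  hasLaw : ∀ I : Finset NNReal, (∀ t ∈ I, (t : ℝ) ≤ T) →
    HasLaw (fun ω (t : I) ↦ X ((t : NNReal) : ℝ) ω) (BrownianReal.projectiveFamily I) P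
  cont : ∀ᵐ ω ∂P, ContinuousOn (fun t ↦ X t ω) (Icc 0 T)

/-- A deterministic step function `∑ i, c i • 𝟙_(t i, t (i + 1)]` on `[0, t]`. -/
structure StepIntegrand (t : ℝ) where
  n : ℕ
  node : Fin (n + 1) → ℝ
  node_mono : Monotone node
  node_mem : ∀ i, node i ∈ Icc 0 t
  coeff : Fin n → ℝ

/-- The value of a step function at `s`. -/
noncomputable def StepIntegrand.eval {t : ℝ} (f : StepIntegrand t) (s : ℝ) : ℝ :=
  ∑ i : Fin f.n, (Ioc (f.node i.castSucc) (f.node i.succ)).indicator (fun _ ↦ f.coeff i) s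

/-- The elementary stochastic integral `∑ i, c i * (W (t (i + 1)) - W (t i))`. -/
def StepIntegrand.integral {Ω : Type*} {t : ℝ} (f : StepIntegrand t) (W : ℝ → Ω → ℝ) (ω : Ω) : ℝ :=
  ∑ i : Fin f.n, f.coeff i * (W (f.node i.succ) ω - W (f.node i.castSucc) ω)

/-- `Y` is (a version of) the Wiener integral `∫₀ᵗ σ_s dW_s` of the deterministic function `σ`:
the `L²(P)` limit of the elementary integrals of step functions that converge to `σ` in
`L²((0, t])`. -/
def IsWienerIntegral {Ω : Type*} [MeasurableSpace Ω] (P : Measure Ω) (W : ℝ → Ω → ℝ)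
    (σ : ℝ → ℝ) (t : ℝ) (Y : Ω → ℝ) : Prop :=
  MemLp Y 2 P ∧ ∃ f : ℕ → StepIntegrand t,
    Tendsto (fun k ↦ eLpNorm (fun s ↦ (f k).eval s - σ s) 2 (volume.restrict (Ioc 0 t)))
      atTop (𝓝 0) ∧
    Tendsto (fun k ↦ eLpNorm (fun ω ↦ (f k).integral W ω - Y ω) 2 P) atTop (𝓝 0)

/-- The path `b` solves `b t = w t + ∫₀ᵗ (x s - b s) / (v s - s) ds` for all `0 ≤ t ≤ T`, where the
integral is a Lebesgue integral for `t < T`, and `∫₀ᵀ` is the limit of `∫₀ᵗ` as `t ↑ T`. -/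
structure IsSolutionPath (T : ℝ) (v x w b : ℝ → ℝ) : Prop where
  integrable : ∀ t ∈ Ico 0 T,
    IntervalIntegrable (fun s ↦ (x s - b s) / (v s - s)) volume 0 t
  eq_of_lt : ∀ t ∈ Ico 0 T, b t = w t + ∫ s in (0 : ℝ)..t, (x s - b s) / (v s - s)
  eq_end : Tendsto (fun t ↦ w T + ∫ s in (0 : ℝ)..t, (x s - b s) / (v s - s)) (𝓝[<] T) (𝓝 (b T))

/-- Almost surely, the path of `B` solves
`B_t = W_t + ∫₀ᵗ (V_s - B_s) / (Var(V_s) - s) ds` for all `0 ≤ t ≤ T`. -/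
def IsSolution {Ω : Type*} [MeasurableSpace Ω] (P : Measure Ω) (T : ℝ) (V W B : ℝ → Ω → ℝ) : Prop :=
  ∀ᵐ ω ∂P, IsSolutionPath T (fun s ↦ Var[V s; P]) (fun s ↦ V s ω) (fun s ↦ W s ω) (fun s ↦ B s ω)

/-! Write `v s = Var V_s` and `h s = v s - s`. Path by path, the equation is a linear ODE: `u = B -
W²` satisfies `u' = (y - u) / h`, `u 0 = 0`, with `y = V - W²`. With the integrating factor `ψ t =
exp (∫₀ᵗ ds / h s)`, its only solution before `T` is `u = ψ⁻¹ ∫ ψ' y` (`IsBridgeRate.eq_average`).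

Since `v` is nondecreasing and `v T = T`, `h t ≤ T - t`; integrability of `1/|h|` then forces `h >
0` on `(0, T)`. Hence `ψ` increases to `∞` at `T`, the weights `ψ'/ψ t` concentrate at `T`, and `u t
→ y T`, that is, `B_t → V_T` (`IsBridgeRate.tendsto_average`). This gives existence, uniqueness and
the terminal value.

For the law, `B_t` lies in the closed Gaussian subspace of `L²(P)` spanned by `W¹`, `W²` and `V₀`,
so only covariances matter. The process `V` is orthogonal to `W²`, and `E V_s V_t = v s` for `s ≤
t`. With `ψ' h = ψ`, every covariance integral has an explicit antiderivative in `ψ` and `Ψ t = ∫₀ᵗ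
ψ`, and everything cancels to `E B_s B_t = s` (`IsWienerPair.inner_solution_solution`,
`inner_solution_right`). The pathwise integral agrees with the integral in `L²(P)` because both are
limits of the same Riemann sums (`coeFn_integral_smul`). -/

/-! ### Positivity of `Var V_s - s` -/

lemma lintegral_enorm_inv_eq_top {f : ℝ → ℝ} {a b c : ℝ} (hab : a < b) (hc : c ∈ Icc a b)
    (hf : ∀ s ∈ Ioc a b, |f s| ≤ |s - c|) : ∫⁻ s in Ioc a b, ‖f s‖ₑ⁻¹ = ⊤ := by
  by_contra hne
  have hnot : ¬ IntervalIntegrable (fun x ↦ (x - c)⁻¹) volume a b := by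
    rw [intervalIntegrable_sub_inv_iff, uIcc_of_le hab.le]
    rintro (h | h)
    · exact hab.ne h
    · exact h hc
  refine hnot ((intervalIntegrable_iff_integrableOn_Ioc_of_le hab.le).2 ⟨?_, ?_⟩)
  · exact (by fun_prop : Measurable fun x : ℝ ↦ (x - c)⁻¹).aestronglyMeasurable
  · refine lt_of_le_of_lt ?_ (lt_top_iff_ne_top.2 hne)
    refine setLIntegral_mono_ae' measurableSet_Ioc (Eventually.of_forall fun s hs ↦ ?_)
    -- At `s = c` the real inverse is `0`, so the left-hand side vanishes.
    rcases eq_or_ne s c with rfl | hsc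
    · simp
    · rw [enorm_inv (sub_ne_zero.2 hsc), ENNReal.inv_le_inv]
      rw [Real.enorm_eq_ofReal_abs, Real.enorm_eq_ofReal_abs]
      exact ENNReal.ofReal_le_ofReal (hf s hs)

/-- If `1 / h` is integrable on `[0, t]` for `t < T` and `h + id` is nondecreasing with `0 ≤ h 0`,
then `h` has no zeros in `(0, T)`. -/
lemma pos_of_lintegral_enorm_inv_lt_top {T : ℝ} {h : ℝ → ℝ} (hc : ContinuousOn h (Icc 0 T))
    (hmono : ∀ s ∈ Icc 0 T, ∀ t ∈ Icc 0 T, s ≤ t → h s - h t ≤ t - s) (h0 : 0 ≤ h 0)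
    (hint : ∀ t ∈ Ico 0 T, ∫⁻ s in Ioc 0 t, ‖h s‖ₑ⁻¹ < ⊤) {t : ℝ} (ht : t ∈ Ioo 0 T) :
    0 < h t := by
  have hnonneg : ∀ t ∈ Ioo 0 T, 0 ≤ h t := by
    intro t ht
    by_contra! hlt
    -- Let `a` be the last point before `t` with `h a ≥ 0`. On `(a, t]`, `h` is negative and `-h s ≤
    -- h a - h s ≤ s - a`, so `1/|h|` is not integrable at `a`.
    set Z : Set ℝ := Icc 0 t ∩ h ⁻¹' Ici 0 with hZ
    have hct : ContinuousOn h (Icc 0 t) := hc.mono (Icc_subset_Icc_right ht.2.le)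
    have hZc : IsCompact Z :=
      isCompact_Icc.of_isClosed_subset (hct.preimage_isClosed_of_isClosed isClosed_Icc isClosed_Ici)
        inter_subset_left
    obtain ⟨a, haZ, hmax⟩ := hZc.exists_isGreatest ⟨0, ⟨le_rfl, ht.1.le⟩, h0⟩
    have hat : a < t := lt_of_le_of_ne haZ.1.2 fun e ↦ by
      have := haZ.2; simp only [mem_preimage, mem_Ici] at this; subst e; linarith
    have hneg : ∀ s ∈ Ioc a t, h s < 0 := by
      intro s hs
      by_contra! hs0
      exact (hmax ⟨⟨haZ.1.1.trans hs.1.le, hs.2⟩, hs0⟩).not_gt hs.1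
    have hbound : ∀ s ∈ Ioc a t, |h s| ≤ |s - a| := by
      intro s hs
      rw [abs_of_neg (hneg s hs), abs_of_pos (sub_pos.2 hs.1)]
      have h1 : 0 ≤ h a := haZ.2
      have := hmono a ⟨haZ.1.1, haZ.1.2.trans ht.2.le⟩ s
        ⟨haZ.1.1.trans hs.1.le, hs.2.trans ht.2.le⟩ hs.1.le
      linarith
    have htop := lintegral_enorm_inv_eq_top hat ⟨le_rfl, hat.le⟩ hbound
    have hle : ∫⁻ s in Ioc a t, ‖h s‖ₑ⁻¹ ≤ ∫⁻ s in Ioc 0 t, ‖h s‖ₑ⁻¹ :=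
      lintegral_mono_set (Ioc_subset_Ioc_left haZ.1.1)
    exact (hle.trans_lt (hint t ⟨ht.1.le, ht.2⟩)).ne htop
  -- If `h t = 0`, then `0 ≤ h s ≤ t - s` to the left of `t`, and `1/h` is not integrable at `t`.
  refine lt_of_le_of_ne (hnonneg t ht) fun h_eq ↦ ?_
  refine (hint t ⟨ht.1.le, ht.2⟩).ne
    (lintegral_enorm_inv_eq_top ht.1 ⟨ht.1.le, le_rfl⟩ fun s hs ↦ ?_)
  rw [abs_of_nonneg (hnonneg s ⟨hs.1, hs.2.trans_lt ht.2⟩), abs_sub_comm,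
    abs_of_nonneg (sub_nonneg.2 hs.2)]
  have := hmono s ⟨hs.1.le, hs.2.trans ht.2.le⟩ t ⟨ht.1.le, ht.2.le⟩ hs.2
  linarith

/-- The conditions on `h` under which the equation `b' = w' + (x - b) / h` on `[0, T]` is uniquely
solvable with `b T = x T`. -/
structure IsBridgeRate (T : ℝ) (h : ℝ → ℝ) : Prop where
  pos_T : 0 < T
  cont : ContinuousOn h (Icc 0 T)
  pos : ∀ t ∈ Ioo 0 T, 0 < h t
  le : ∀ t ∈ Ioo 0 T, h t ≤ T - t
  intervalIntegrable : ∀ t ∈ Ico 0 T, IntervalIntegrable (fun s ↦ (h s)⁻¹) volume 0 t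

lemma isBridgeRate_of_monotone {T : ℝ} {h : ℝ → ℝ} (hT : 0 < T) (hc : ContinuousOn h (Icc 0 T))
    (hmono : ∀ s ∈ Icc 0 T, ∀ t ∈ Icc 0 T, s ≤ t → h s - h t ≤ t - s) (h0 : 0 ≤ h 0)
    (hhT : h T = 0) (hint : ∀ t ∈ Ico 0 T, ∫⁻ s in Ioc 0 t, ‖h s‖ₑ⁻¹ < ⊤) :
    IsBridgeRate T h where
  pos_T := hT
  cont := hc
  pos _ ht := pos_of_lintegral_enorm_inv_lt_top hc hmono h0 hint ht
  le t ht := by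
    have := hmono t ⟨ht.1.le, ht.2.le⟩ T ⟨hT.le, le_rfl⟩ ht.2.le
    linarith
  intervalIntegrable t ht := by
    refine (intervalIntegrable_iff_integrableOn_Ioc_of_le ht.1).2 ⟨?_, ?_⟩
    · have : ContinuousOn h (Ioc 0 t) :=
        hc.mono fun s hs ↦ ⟨hs.1.le, hs.2.trans ht.2.le⟩
      exact (this.aemeasurable measurableSet_Ioc).inv.aestronglyMeasurable
    · refine lt_of_le_of_lt ?_ (hint t ht)
      refine setLIntegral_mono_ae' measurableSet_Ioc (Eventually.of_forall fun s hs ↦ ?_)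
      rcases eq_or_ne (h s) 0 with h | h
      · simp [h]
      · rw [enorm_inv h]

/-! ### The integrating factor -/

namespace IsBridgeRate

/-- The integrating factor `exp (∫₀ᵗ ds / h s)`. -/
noncomputable def factor (h : ℝ → ℝ) (t : ℝ) : ℝ := Real.exp (∫ s in (0 : ℝ)..t, (h s)⁻¹)

/-- The derivative of the integrating factor. -/
noncomputable def weight (h : ℝ → ℝ) (t : ℝ) : ℝ := factor h t * (h t)⁻¹

variable {T : ℝ} {h : ℝ → ℝ}

lemma factor_pos (t : ℝ) : 0 < factor h t := Real.exp_pos _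

lemma factor_zero : factor h 0 = 1 := by simp [factor]

lemma continuousOn_factor (H : IsBridgeRate T h) {t : ℝ} (ht : t ∈ Ico 0 T) :
    ContinuousOn (factor h) (Icc 0 t) := by
  refine Real.continuous_exp.comp_continuousOn ?_
  have := intervalIntegral.continuousOn_primitive_interval (μ := volume)
    (f := fun s ↦ (h s)⁻¹) (a := 0) (b := t)
    ((intervalIntegrable_iff' (by simp)).1 (H.intervalIntegrable t ht))
  rwa [uIcc_of_le ht.1] at this

lemma continuousAt (H : IsBridgeRate T h) {t : ℝ} (ht : t ∈ Ioo 0 T) : ContinuousAt h t :=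
  H.cont.continuousAt (Icc_mem_nhds ht.1 ht.2)

lemma hasDerivAt_integral {E : Type*} [NormedAddCommGroup E]
    [NormedSpace ℝ E] [CompleteSpace E] {f : ℝ → E} {t : ℝ} (ht : t ∈ Ioo 0 T)
    (hf : ∀ s ∈ Ico 0 T, IntervalIntegrable f volume 0 s) (hc : ContinuousAt f t) :
    HasDerivAt (fun t ↦ ∫ s in (0 : ℝ)..t, f s) (f t) t := by
  refine intervalIntegral.integral_hasDerivAt_right (hf t ⟨ht.1.le, ht.2⟩) ?_ hc
  obtain ⟨s, hs⟩ := exists_between ht.2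
  have := hf s ⟨(ht.1.trans hs.1).le, hs.2⟩
  rw [intervalIntegrable_iff_integrableOn_Ioc_of_le (ht.1.trans hs.1).le] at this
  exact ⟨Ioc 0 s, Ioc_mem_nhds ht.1 hs.1, this.aestronglyMeasurable⟩

lemma hasDerivAt_factor (H : IsBridgeRate T h) {t : ℝ} (ht : t ∈ Ioo 0 T) :
    HasDerivAt (factor h) (weight h t) t :=
  (hasDerivAt_integral ht H.intervalIntegrable
    ((H.continuousAt ht).inv₀ (H.pos t ht).ne')).exp

lemma continuousAt_weight (H : IsBridgeRate T h) {t : ℝ} (ht : t ∈ Ioo 0 T) :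
    ContinuousAt (weight h) t :=
  (H.hasDerivAt_factor ht).continuousAt.mul ((H.continuousAt ht).inv₀ (H.pos t ht).ne')

lemma intervalIntegrable_weight (H : IsBridgeRate T h) {t : ℝ} (ht : t ∈ Ico 0 T) :
    IntervalIntegrable (weight h) volume 0 t :=
  (H.intervalIntegrable t ht).continuousOn_mul (by
    rw [uIcc_of_le ht.1]; exact H.continuousOn_factor ht)

lemma intervalIntegrable_weight_smul (H : IsBridgeRate T h) {E : Type*} [NormedAddCommGroup E]
    [NormedSpace ℝ E] {x : ℝ → E} {t : ℝ} (ht : t ∈ Ico 0 T)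
    (hx : ContinuousOn x (Icc 0 T)) :
    IntervalIntegrable (fun s ↦ weight h s • x s) volume 0 t := by
  refine (H.intervalIntegrable_weight ht).smul_continuousOn ?_
  rw [uIcc_of_le ht.1]
  exact hx.mono (Icc_subset_Icc_right ht.2.le)

lemma weight_mul (H : IsBridgeRate T h) {t : ℝ} (ht : t ∈ Ioo 0 T) :
    weight h t * h t = factor h t := by
  rw [weight, mul_assoc, inv_mul_cancel₀ (H.pos t ht).ne', mul_one]

lemma weight_nonneg (H : IsBridgeRate T h) {t : ℝ} (ht : t ∈ Ioo 0 T) : 0 ≤ weight h t :=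
  mul_nonneg (factor_pos t).le (inv_nonneg.2 (H.pos t ht).le)

/-- The fundamental theorem of calculus on `[s, t] ⊆ [0, T)`, with derivatives in `(s, t)` only. -/
lemma integral_eq_sub {F f : ℝ → ℝ} {s t : ℝ} (hst : s ≤ t) (hF : ContinuousOn F (Icc s t))
    (hF' : ∀ r ∈ Ioo s t, HasDerivAt F (f r) r) (hf : IntervalIntegrable f volume s t) :
    ∫ r in s..t, f r = F t - F s :=
  intervalIntegral.integral_eq_sub_of_hasDerivAt_of_le hst hF hF' hf

lemma integral_weight (H : IsBridgeRate T h) {s t : ℝ} (hs : s ∈ Ico 0 T) (ht : t ∈ Ico 0 T) :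
    ∫ r in s..t, weight h r = factor h t - factor h s := by
  have key : ∀ t ∈ Ico 0 T, ∫ r in (0 : ℝ)..t, weight h r = factor h t - factor h 0 :=
    fun t ht ↦ integral_eq_sub ht.1 (H.continuousOn_factor ht)
      (fun r hr ↦ H.hasDerivAt_factor ⟨hr.1, hr.2.trans ht.2⟩) (H.intervalIntegrable_weight ht)
  have := intervalIntegral.integral_interval_sub_left (H.intervalIntegrable_weight ht)
    (H.intervalIntegrable_weight hs)
  rw [← this, key t ht, key s hs]
  ring

/-- The bound `h s ≤ T - s` gives `∫₀ᵗ ds / h s ≥ log T - log (T - t)`. -/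
lemma tendsto_factor (H : IsBridgeRate T h) : Tendsto (factor h) (𝓝[<] T) atTop := by
  refine Real.tendsto_exp_atTop.comp ?_
  have hlog : Tendsto (fun t ↦ Real.log T - Real.log (T - t)) (𝓝[<] T) atTop := by
    refine tendsto_atTop_add_const_left _ _ (tendsto_neg_atBot_atTop.comp ?_)
    refine Real.tendsto_log_nhdsGT_zero.comp ?_
    refine tendsto_nhdsWithin_iff.2 ⟨?_, ?_⟩
    · have : Tendsto (fun t ↦ T - t) (𝓝 T) (𝓝 (T - T)) := tendsto_const_nhds.sub tendsto_id
      rw [sub_self] at this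
      exact this.mono_left nhdsWithin_le_nhds
    · filter_upwards [self_mem_nhdsWithin] with t ht
      exact sub_pos.2 (mem_Iio.1 ht)
  refine tendsto_atTop_mono' _ ?_ hlog
  filter_upwards [Ioo_mem_nhdsLT H.pos_T] with t ht
  have hcont : ContinuousOn (fun s ↦ (T - s)⁻¹) (Icc 0 t) :=
    (continuousOn_const.sub continuousOn_id).inv₀ fun s hs ↦ by
      simpa using (sub_pos.2 (hs.2.trans_lt ht.2)).ne'
  have hI : IntervalIntegrable (fun s ↦ (T - s)⁻¹) volume 0 t :=
    ContinuousOn.intervalIntegrable (by rwa [uIcc_of_le ht.1.le])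
  have e : ∫ s in (0 : ℝ)..t, (T - s)⁻¹ = Real.log T - Real.log (T - t) := by
    rw [integral_eq_sub (F := fun s ↦ - Real.log (T - s)) ht.1.le]
    · simp [neg_add_eq_sub]
    · refine ContinuousOn.neg (ContinuousOn.log (by fun_prop) fun s hs ↦ ?_)
      exact (sub_pos.2 (hs.2.trans_lt ht.2)).ne'
    · intro r hr
      have hd := (((hasDerivAt_id r).const_sub T).log
        (by simpa using (sub_pos.2 (hr.2.trans ht.2)).ne')).neg
      exact hd.congr_deriv (by simp [neg_div])
    · exact hI
  rw [← e]
  refine intervalIntegral.integral_mono_on_of_le_Ioo ht.1.le hI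
    (H.intervalIntegrable t ⟨ht.1.le, ht.2⟩) fun s hs ↦ ?_
  have hs' : s ∈ Ioo 0 T := ⟨hs.1, hs.2.trans ht.2⟩
  exact inv_anti₀ (H.pos s hs') (H.le s hs')

end IsBridgeRate

/-! ### The pathwise linear equation -/

namespace IsBridgeRate

/-- The solution of `u' = (y - u) / h`, `u 0 = 0`: a weighted average of `y`. -/
noncomputable def average (h y : ℝ → ℝ) (t : ℝ) : ℝ :=
  (factor h t)⁻¹ * ∫ s in (0 : ℝ)..t, weight h s * y s

variable {T : ℝ} {h x w y b : ℝ → ℝ}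

lemma average_zero : average h y 0 = 0 := by simp [average]

lemma intervalIntegrable_weight_mul (H : IsBridgeRate T h) {t : ℝ} (ht : t ∈ Ico 0 T)
    (hy : ContinuousOn y (Icc 0 T)) :
    IntervalIntegrable (fun s ↦ weight h s * y s) volume 0 t :=
  H.intervalIntegrable_weight_smul ht hy

lemma continuousOn_primitive {E : Type*} [NormedAddCommGroup E] [NormedSpace ℝ E]
    {f : ℝ → E} {t : ℝ} (ht : 0 ≤ t) (hf : IntervalIntegrable f volume 0 t) :
    ContinuousOn (fun t ↦ ∫ s in (0 : ℝ)..t, f s) (Icc 0 t) := by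
  have := intervalIntegral.continuousOn_primitive_interval (μ := volume) (f := f) (a := 0) (b := t)
    ((intervalIntegrable_iff' (by simp)).1 hf)
  rwa [uIcc_of_le ht] at this

lemma continuousOn_average (H : IsBridgeRate T h) (hy : ContinuousOn y (Icc 0 T)) {t : ℝ}
    (ht : t ∈ Ico 0 T) : ContinuousOn (average h y) (Icc 0 t) :=
  ((H.continuousOn_factor ht).inv₀ fun s _ ↦ (factor_pos s).ne').mul
    (continuousOn_primitive ht.1 (H.intervalIntegrable_weight_mul ht hy))

lemma hasDerivAt_average (H : IsBridgeRate T h) (hy : ContinuousOn y (Icc 0 T)) {t : ℝ}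
    (ht : t ∈ Ioo 0 T) : HasDerivAt (average h y) ((y t - average h y t) / h t) t := by
  have hf := (H.hasDerivAt_factor ht).inv (factor_pos t).ne'
  have hI := hasDerivAt_integral (f := fun s ↦ weight h s * y s) ht
    (fun s hs ↦ H.intervalIntegrable_weight_mul hs hy)
    ((H.continuousAt_weight ht).mul (hy.continuousAt (Icc_mem_nhds ht.1 ht.2)))
  refine (hf.mul hI).congr_deriv ?_
  have h1 := (factor_pos (h := h) t).ne'
  have h2 := (H.pos t ht).ne'
  simp only [Pi.inv_apply, average, weight]
  field_simp
  ring

lemma intervalIntegrable_div (H : IsBridgeRate T h) {t : ℝ} (ht : t ∈ Ico 0 T)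
    (hy : ContinuousOn y (Icc 0 t)) :
    IntervalIntegrable (fun s ↦ y s / h s) volume 0 t :=
  (H.intervalIntegrable t ht).continuousOn_mul (by rwa [uIcc_of_le ht.1])

lemma integral_sub_average_div (H : IsBridgeRate T h) (hy : ContinuousOn y (Icc 0 T)) {t : ℝ}
    (ht : t ∈ Ico 0 T) :
    ∫ s in (0 : ℝ)..t, (y s - average h y s) / h s = average h y t := by
  rw [integral_eq_sub ht.1 (H.continuousOn_average hy ht)
    (fun r hr ↦ H.hasDerivAt_average hy ⟨hr.1, hr.2.trans ht.2⟩)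
    (H.intervalIntegrable_div ht ((hy.mono (Icc_subset_Icc_right ht.2.le)).sub
      (H.continuousOn_average hy ht))), average_zero, sub_zero]

/-- The integral equation makes `u` continuous, hence differentiable on `(0, T)`; then `(u ψ)' = ψ'
y` determines `u ψ`. Derivatives are taken in the open interval only, as `h 0 = 0` is possible. -/
lemma eq_average (H : IsBridgeRate T h) (hy : ContinuousOn y (Icc 0 T)) {u : ℝ → ℝ}
    (hi : ∀ t ∈ Ico 0 T, IntervalIntegrable (fun s ↦ (y s - u s) / h s) volume 0 t)
    (hu : ∀ t ∈ Ico 0 T, u t = ∫ s in (0 : ℝ)..t, (y s - u s) / h s) {t : ℝ} (ht : t ∈ Ico 0 T) :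
    u t = average h y t := by
  have hcont : ∀ t ∈ Ico 0 T, ContinuousOn u (Icc 0 t) := fun t ht ↦
    (continuousOn_primitive ht.1 (hi t ht)).congr fun s hs ↦ hu s ⟨hs.1, hs.2.trans_lt ht.2⟩
  have hcat : ∀ t ∈ Ioo 0 T, ContinuousAt u t := fun t ht ↦ by
    obtain ⟨s, hs⟩ := exists_between ht.2
    exact (hcont s ⟨(ht.1.trans hs.1).le, hs.2⟩).continuousAt (Icc_mem_nhds ht.1 hs.1)
  have hderiv : ∀ t ∈ Ioo 0 T, HasDerivAt u ((y t - u t) / h t) t := fun t ht ↦ by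
    have := hasDerivAt_integral ht hi
      (((hy.continuousAt (Icc_mem_nhds ht.1 ht.2)).sub (hcat t ht)).div₀ (H.continuousAt ht)
        (H.pos t ht).ne')
    refine this.congr_of_eventuallyEq ?_
    filter_upwards [Ioo_mem_nhds ht.1 ht.2] with s hs using hu s ⟨hs.1.le, hs.2⟩
  have key := integral_eq_sub (F := fun t ↦ u t * factor h t) (f := fun s ↦ weight h s * y s) ht.1
    ((hcont t ht).mul (H.continuousOn_factor ht)) (fun r hr ↦ by
      have hr' : r ∈ Ioo 0 T := ⟨hr.1, hr.2.trans ht.2⟩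
      refine ((hderiv r hr').mul (H.hasDerivAt_factor hr')).congr_deriv ?_
      have := (H.pos r hr').ne'
      simp only [weight]
      field_simp
      ring) (H.intervalIntegrable_weight_mul ht hy)
  have h0 : u 0 = 0 := by
    simpa using hu 0 ⟨le_rfl, H.pos_T⟩
  rw [average, key, h0]
  have := (factor_pos (h := h) t).ne'
  field_simp
  ring

/-- The weights on `[0, t]` have total mass `1 - 1/ψ t → 1`, and any fixed `[0, a]` with `a < T`
loses its share as `ψ t → ∞`. On `[a, t]`, `y` is close to `y T`. -/
lemma tendsto_average (H : IsBridgeRate T h) (hy : ContinuousOn y (Icc 0 T)) :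
    Tendsto (average h y) (𝓝[<] T) (𝓝 (y T)) := by
  have hinv : Tendsto (fun t ↦ (factor h t)⁻¹) (𝓝[<] T) (𝓝 0) :=
    tendsto_inv_atTop_zero.comp H.tendsto_factor
  rw [Metric.tendsto_nhds]
  intro ε hε
  have hyT : ContinuousWithinAt y (Icc 0 T) T := hy T ⟨H.pos_T.le, le_rfl⟩
  obtain ⟨δ, hδ, hy'⟩ := Metric.continuousWithinAt_iff.1 hyT (ε / 3) (by positivity)
  obtain ⟨a, ha⟩ := exists_between (max_lt H.pos_T (sub_lt_self T hδ))
  have ha0 : 0 < a := (le_max_left _ _).trans_lt ha.1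
  have haδ : T - δ < a := (le_max_right _ _).trans_lt ha.1
  have haI : a ∈ Ico 0 T := ⟨ha0.le, ha.2⟩
  set C := (∫ s in (0 : ℝ)..a, weight h s * (y s - y T)) with hC
  have h1 : Tendsto (fun t ↦ (factor h t)⁻¹ * (C - y T)) (𝓝[<] T) (𝓝 0) := by
    simpa using hinv.mul_const (C - y T)
  filter_upwards [Metric.tendsto_nhds.1 h1 (ε / 3) (by positivity), Ioo_mem_nhdsLT ha.2]
    with t ht1 ht
  have htI : t ∈ Ico 0 T := ⟨(ha0.trans ht.1).le, ht.2⟩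
  have hyc : ContinuousOn (fun s ↦ y s - y T) (Icc 0 T) := hy.sub continuousOn_const
  have hi := H.intervalIntegrable_weight_mul htI hyc
  have hia := H.intervalIntegrable_weight_mul haI hyc
  have hψ := factor_pos (h := h) t
  -- The term `-y T` is the mass `1/ψ t` missing from the weights.
  have e : average h y t - y T = (factor h t)⁻¹ * (C - y T) +
      (factor h t)⁻¹ * ∫ s in a..t, weight h s * (y s - y T) := by
    have e1 : ∫ s in (0 : ℝ)..t, weight h s * (y s - y T) =
        (∫ s in (0 : ℝ)..t, weight h s * y s) - (factor h t - 1) * y T := by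
      simp_rw [mul_sub]
      rw [intervalIntegral.integral_sub (H.intervalIntegrable_weight_mul htI hy)
        ((H.intervalIntegrable_weight htI).mul_const _), intervalIntegral.integral_mul_const,
        H.integral_weight ⟨le_rfl, H.pos_T⟩ htI, factor_zero]
    have e2 := intervalIntegral.integral_add_adjacent_intervals hia (hia.symm.trans hi)
    rw [average]
    have e3 : ∫ s in (0 : ℝ)..t, weight h s * y s =
        C + (∫ s in a..t, weight h s * (y s - y T)) + (factor h t - 1) * y T := by
      linarith
    rw [e3]
    field_simp
    ring
  have hbd : |∫ s in a..t, weight h s * (y s - y T)| ≤ (factor h t - factor h a) * (ε / 3) := by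
    rw [← H.integral_weight haI htI, ← intervalIntegral.integral_mul_const, ← Real.norm_eq_abs]
    refine intervalIntegral.norm_integral_le_of_norm_le ht.1.le ?_
      (((H.intervalIntegrable_weight haI).symm.trans (H.intervalIntegrable_weight htI)).mul_const _)
    refine Eventually.of_forall fun s hs ↦ ?_
    have hs' : s ∈ Ioo 0 T := ⟨ha0.trans hs.1, hs.2.trans_lt ht.2⟩
    rw [norm_mul, Real.norm_of_nonneg (H.weight_nonneg hs')]
    refine mul_le_mul_of_nonneg_left ?_ (H.weight_nonneg hs')
    have := hy' (x := s) ⟨hs'.1.le, hs'.2.le⟩ (by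
      rw [Real.dist_eq, abs_lt]; constructor <;> linarith [hs.1, hs'.2])
    rw [Real.dist_eq] at this
    exact this.le
  rw [Real.dist_eq, e]
  rw [Real.dist_eq, sub_zero] at ht1
  refine (abs_add_le _ _).trans_lt ?_
  have h3 : |(factor h t)⁻¹ * ∫ s in a..t, weight h s * (y s - y T)| ≤ ε / 3 := by
    rw [abs_mul, abs_of_pos (inv_pos.2 hψ), inv_mul_le_iff₀ hψ]
    refine hbd.trans ?_
    have := factor_pos (h := h) a
    gcongr
    linarith
  linarith

variable {v : ℝ → ℝ}

/-- The pathwise solution of the equation. -/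
lemma isSolutionPath_iff (H : IsBridgeRate T (fun s ↦ v s - s)) (hx : ContinuousOn x (Icc 0 T))
    (hw : ContinuousOn w (Icc 0 T)) :
    IsSolutionPath T v x w b ↔
      (∀ t ∈ Ico 0 T, b t = w t + average (fun s ↦ v s - s) (fun s ↦ x s - w s) t) ∧ b T = x T := by
  set h : ℝ → ℝ := fun s ↦ v s - s with hh
  have hy : ContinuousOn (fun s ↦ x s - w s) (Icc 0 T) := hx.sub hw
  have hlim : Tendsto (fun t ↦ w T + average h (fun s ↦ x s - w s) t) (𝓝[<] T) (𝓝 (x T)) := by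
    simpa using (H.tendsto_average hy).const_add (w T)
  have hmem : ∀ᶠ t in 𝓝[<] T, t ∈ Ico 0 T := by
    filter_upwards [Ioo_mem_nhdsLT H.pos_T] with t ht using ⟨ht.1.le, ht.2⟩
  constructor
  · intro hb
    -- Subtracting `w` from both `x` and `b` turns the equation into the one solved by `average`.
    have e : (fun s ↦ (x s - b s) / (v s - s)) = fun s ↦ ((x s - w s) - (b s - w s)) / h s := by
      simp [hh]
    have hu : ∀ t ∈ Ico 0 T, b t - w t = average h (fun s ↦ x s - w s) t := by
      refine fun t ht ↦ H.eq_average hy (u := fun s ↦ b s - w s) (fun t ht ↦ ?_) (fun t ht ↦ ?_) ht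
      · have := hb.integrable t ht
        rwa [e] at this
      · have := hb.eq_of_lt t ht
        rw [e] at this
        linarith
    refine ⟨fun t ht ↦ by linarith [hu t ht], tendsto_nhds_unique hb.eq_end (hlim.congr' ?_)⟩
    filter_upwards [hmem] with t ht
    have := hb.eq_of_lt t ht
    have := hu t ht
    linarith
  · rintro ⟨hb, hbT⟩
    have hcongr : ∀ t ∈ Ico 0 T, EqOn (fun s ↦ (x s - b s) / (v s - s))
        (fun s ↦ ((x s - w s) - average h (fun s ↦ x s - w s) s) / h s) (Icc 0 t) := by
      intro t ht s hs
      simp only [hb s ⟨hs.1, hs.2.trans_lt ht.2⟩, hh]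
      ring
    have hint : ∀ t ∈ Ico 0 T, ∫ s in (0 : ℝ)..t, (x s - b s) / (v s - s) =
        average h (fun s ↦ x s - w s) t := by
      intro t ht
      rw [← H.integral_sub_average_div hy ht]
      exact intervalIntegral.integral_congr (by rw [uIcc_of_le ht.1]; exact hcongr t ht)
    refine ⟨fun t ht ↦ ?_, fun t ht ↦ by rw [hint t ht, hb t ht], ?_⟩
    · refine (H.intervalIntegrable_div ht ((hy.mono (Icc_subset_Icc_right ht.2.le)).sub
        (H.continuousOn_average hy ht))).congr fun s hs ↦ ?_
      rw [uIoc_of_le ht.1] at hs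
      exact (hcongr t ht ⟨hs.1.le, hs.2⟩).symm
    · rw [hbT]
      refine hlim.congr' ?_
      filter_upwards [hmem] with t ht
      rw [hint t ht]

lemma continuousOn_of_isSolutionPath (H : IsBridgeRate T (fun s ↦ v s - s))
    (hx : ContinuousOn x (Icc 0 T)) (hw : ContinuousOn w (Icc 0 T))
    (hb : IsSolutionPath T v x w b) : ContinuousOn b (Icc 0 T) := by
  obtain ⟨hb, hbT⟩ := (H.isSolutionPath_iff hx hw).1 hb
  have hy : ContinuousOn (fun s ↦ x s - w s) (Icc 0 T) := hx.sub hw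
  intro t ht
  rcases ht.2.lt_or_eq with htT | rfl
  · obtain ⟨s, hs⟩ := exists_between htT
    have hs0 : s ∈ Ico 0 T := ⟨ht.1.trans hs.1.le, hs.2⟩
    have hc : ContinuousOn b (Icc 0 s) :=
      ((hw.mono (Icc_subset_Icc_right hs.2.le)).add (H.continuousOn_average hy hs0)).congr
        fun r hr ↦ hb r ⟨hr.1, hr.2.trans_lt hs.2⟩
    refine (hc t ⟨ht.1, hs.1.le⟩).mono_of_mem_nhdsWithin ?_
    filter_upwards [self_mem_nhdsWithin, mem_nhdsWithin_of_mem_nhds (Iio_mem_nhds hs.1)]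
      with r hr hr' using ⟨hr.1, (mem_Iio.1 hr').le⟩
  · rw [← continuousWithinAt_sdiff_self]
    have hsub : Icc 0 t \ {t} ⊆ Ico 0 t := fun s hs ↦ ⟨hs.1.1, lt_of_le_of_ne hs.1.2 hs.2⟩
    refine ContinuousWithinAt.mono ?_ hsub
    have h1 : Tendsto w (𝓝[Ico 0 t] t) (𝓝 (w t)) :=
      (hw t ht).mono_left (nhdsWithin_mono _ Ico_subset_Icc_self)
    have h2 := (H.tendsto_average hy).mono_left
      (nhdsWithin_mono t (fun s hs ↦ hs.2 : Ico 0 t ⊆ Iio t))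
    have := h1.add h2
    rw [add_sub_cancel, ← hbT] at this
    refine this.congr' ?_
    filter_upwards [self_mem_nhdsWithin] with s hs using (hb s hs).symm

end IsBridgeRate

/-! ### Gaussian subspaces of `L²(P)` -/

section GaussianSpace

variable {Ω : Type*} [MeasurableSpace Ω] {P : Measure Ω}

lemma coeFn_sum_smul {α ι : Type*} [MeasurableSpace α] {μ : Measure α} (s : Finset ι)
    (c : ι → ℝ) (X : ι → Lp ℝ 2 μ) :
    ⇑(∑ i ∈ s, c i • X i) =ᵐ[μ] fun ω ↦ ∑ i ∈ s, c i * X i ω := by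
  classical
  induction s using Finset.induction_on with
  | empty => simpa using! Lp.coeFn_zero ℝ 2 μ
  | insert a s ha ih =>
    rw [Finset.sum_insert ha]
    filter_upwards [ih, Lp.coeFn_add (c a • X a) (∑ i ∈ s, c i • X i), Lp.coeFn_smul (c a) (X a)]
      with ω h1 h2 h3
    rw [h2, Pi.add_apply, h1, h3, Finset.sum_insert ha]
    simp

lemma inner_toLp {X Y : Ω → ℝ} (hX : MemLp X 2 P) (hY : MemLp Y 2 P) :
    inner ℝ (hX.toLp X) (hY.toLp Y) = ∫ ω, X ω * Y ω ∂P := by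
  rw [L2.inner_def]
  refine integral_congr_ae ?_
  filter_upwards [hX.coeFn_toLp, hY.coeFn_toLp] with ω h1 h2
  simp [h1, h2, mul_comm]

/-- A linear subspace of `L²(P)` that consists of centred Gaussian random variables. -/
def IsGaussianSpace (S : Submodule ℝ (Lp ℝ 2 P)) : Prop :=
  ∀ Z ∈ S, HasLaw Z (gaussianReal 0 (‖Z‖₊ ^ 2)) P

lemma variance_Lp {Z : Lp ℝ 2 P} (hZ : ∫ ω, Z ω ∂P = 0) : Var[Z; P] = ‖Z‖ ^ 2 := by
  rw [variance_of_integral_eq_zero (Lp.aestronglyMeasurable Z).aemeasurable hZ,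
    ← real_inner_self_eq_norm_sq, L2.inner_def]
  refine integral_congr_ae (Eventually.of_forall fun ω ↦ ?_)
  simp [pow_two]

lemma hasLaw_gaussianReal_Lp [IsProbabilityMeasure P] {Z : Lp ℝ 2 P} (hG : HasGaussianLaw Z P) (hZ : ∫ ω, Z ω ∂P = 0) :
    HasLaw Z (gaussianReal 0 (‖Z‖₊ ^ 2)) P := by
  refine ⟨hG.aemeasurable, ?_⟩
  rw [hG.map_eq_gaussianReal, hZ, variance_Lp hZ]
  congr 1
  ext
  simp

lemma IsGaussianSpace.integral_eq_zero {S : Submodule ℝ (Lp ℝ 2 P)} (hS : IsGaussianSpace S)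
    {Z : Lp ℝ 2 P} (hZ : Z ∈ S) : ∫ ω, Z ω ∂P = 0 := by
  rw [(hS Z hZ).integral_eq, integral_id_gaussianReal]

/-- Convergence in `L²` implies convergence in distribution, and the characteristic function of a
centred Gaussian depends continuously on its `L²` norm. -/
lemma IsGaussianSpace.topologicalClosure [IsProbabilityMeasure P] {S : Submodule ℝ (Lp ℝ 2 P)} (hS : IsGaussianSpace S) :
    IsGaussianSpace S.topologicalClosure := by
  intro Z hZ
  obtain ⟨u, hu, hlim⟩ := mem_closure_iff_seq_limit.1 (show Z ∈ closure (S : Set (Lp ℝ 2 P)) from hZ)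
  have hm : ∀ n, AEMeasurable (u n) P := fun n ↦ (Lp.aestronglyMeasurable (u n)).aemeasurable
  have hZm : AEMeasurable Z P := (Lp.aestronglyMeasurable Z).aemeasurable
  have hD := (tendstoInMeasure_of_tendsto_Lp hlim).tendstoInDistribution hm
  refine ⟨hZm, ?_⟩
  have := Measure.isProbabilityMeasure_map (μ := P) hZm
  refine Measure.ext_of_charFun (funext fun t ↦ ?_)
  have h1 := ProbabilityMeasure.tendsto_iff_tendsto_charFun.1 hD.tendsto t
  have h2 : Tendsto (fun n ↦ charFun (P.map (u n)) t) atTop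
      (𝓝 (charFun (gaussianReal 0 (‖Z‖₊ ^ 2)) t)) := by
    simp_rw [fun n ↦ (hS (u n) (hu n)).map_eq, charFun_gaussianReal]
    have hn : Tendsto (fun n ↦ ‖u n‖) atTop (𝓝 ‖Z‖) := hlim.norm
    have hn' : Tendsto (fun n ↦ ((‖u n‖ : ℝ) : ℂ)) atTop (𝓝 (‖Z‖ : ℝ)) :=
      (Complex.continuous_ofReal.tendsto _).comp hn
    refine (Complex.continuous_exp.tendsto _).comp ?_
    simpa using ((hn'.pow 2).mul_const ((t : ℂ) ^ 2)).div_const 2 |>.const_sub 0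
  exact tendsto_nhds_unique h1 h2

lemma isGaussianSpace_span [IsProbabilityMeasure P] {ι : Type*} {X : ι → Lp ℝ 2 P}
    (hX : IsGaussianProcess (fun i ω ↦ X i ω) P) (h0 : ∀ i, ∫ ω, X i ω ∂P = 0) :
    IsGaussianSpace (Submodule.span ℝ (range X)) := by
  intro Z hZ
  obtain ⟨c, rfl⟩ := Finsupp.mem_span_range_iff_exists_finsupp.1 hZ
  have e := coeFn_sum_smul c.support c X
  refine hasLaw_gaussianReal_Lp ?_ ?_
  · exact ((hX.smul c).hasGaussianLaw_fun_sum (I := c.support)).congr e.symm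
  · rw [Finsupp.sum, integral_congr_ae e, integral_finsetSum]
    · simp [integral_const_mul, h0]
    · exact fun i _ ↦ ((Lp.memLp (X i)).integrable (by norm_num)).const_mul _

/-- A random vector is Gaussian if all its linear functionals are, and these are again elements of
`S`. -/
lemma IsGaussianSpace.hasGaussianLaw_pi {S : Submodule ℝ (Lp ℝ 2 P)} (hS : IsGaussianSpace S)
    {ι : Type*} [Fintype ι] {Y : ι → Lp ℝ 2 P} (hY : ∀ i, Y i ∈ S) :
    HasGaussianLaw (fun ω i ↦ Y i ω) P := by
  classical
  have hm : AEMeasurable (fun ω i ↦ Y i ω) P :=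
    aemeasurable_pi_lambda _ fun i ↦ (Lp.aestronglyMeasurable (Y i)).aemeasurable
  refine ⟨isGaussian_of_isGaussian_map fun L ↦ ?_⟩
  rw [AEMeasurable.map_map_of_aemeasurable (by fun_prop) hm]
  set c : ι → ℝ := fun i ↦ L (Pi.single i 1)
  have hZ : ∑ i, c i • Y i ∈ S := Submodule.sum_mem _ fun i _ ↦ S.smul_mem _ (hY i)
  refine ((hS _ hZ).hasGaussianLaw.congr ?_).isGaussian_map
  filter_upwards [coeFn_sum_smul Finset.univ c Y] with ω hω
  rw [hω, Function.comp_apply, ← L.coe_coe, LinearMap.pi_apply_eq_sum_univ]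
  simp only [smul_eq_mul, ContinuousLinearMap.coe_coe, c, mul_comm]
  refine Finset.sum_congr rfl fun i _ ↦ ?_
  congr 2
  ext j
  simp [Pi.single_apply, eq_comm]

/-- Random variables in a Gaussian space are a Brownian motion if their covariances are. -/
lemma IsGaussianSpace.hasLaw_projectiveFamily [IsProbabilityMeasure P] {S : Submodule ℝ (Lp ℝ 2 P)}
    (hS : IsGaussianSpace S) (I : Finset NNReal) {Y : I → Lp ℝ 2 P} (hY : ∀ i, Y i ∈ S)
    (hin : ∀ s t : I, s.1 ≤ t.1 → inner ℝ (Y s) (Y t) = (s.1 : ℝ)) :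
    HasLaw (fun ω i ↦ Y i ω) (BrownianReal.projectiveFamily I) P := by
  have hG := hS.hasGaussianLaw_pi hY
  have hm : ∀ i, AEMeasurable (Y i) P := fun i ↦ (Lp.aestronglyMeasurable (Y i)).aemeasurable
  have hcov : ∀ s t : I, s.1 ≤ t.1 → cov[Y s, Y t; P] = (s.1 : ℝ) := fun s t hst ↦ by
    rw [covariance_eq_sub (Lp.memLp _) (Lp.memLp _), hS.integral_eq_zero (hY s), zero_mul,
      sub_zero, ← hin s t hst, L2.inner_def]
    exact integral_congr_ae (Eventually.of_forall fun ω ↦ by simp [mul_comm])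
  refine ⟨hG.aemeasurable, ?_⟩
  -- On Euclidean space, a Gaussian measure is determined by its mean and its covariance form.
  apply (MeasurableEquiv.toLp 2 (_ → ℝ)).map_measurableEquiv_injective
  rw [MeasurableEquiv.coe_toLp, ← PiLp.coe_symm_continuousLinearEquiv 2 ℝ]
  have := hG.isGaussian_map
  apply IsGaussian.ext
  · rw [integral_map, integral_map, integral_map]
    · simp only [id_eq]
      rw [ContinuousLinearEquiv.integral_comp_id_comm,
        ContinuousLinearEquiv.integral_comp_comm]
      simp only [PiLp.continuousLinearEquiv_symm_apply, BrownianReal.integral_id_projectiveFamily,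
        WithLp.toLp_zero, WithLp.toLp_eq_zero]
      congr with i
      rw [eval_integral]
      · simpa using hS.integral_eq_zero (hY i)
      · exact fun i ↦ (Lp.memLp (Y i)).integrable (by norm_num)
    any_goals fun_prop
  · rw [← ContinuousLinearMap.toBilinForm_inj]
    refine LinearMap.BilinForm.ext_of_isSymm isPosSemidef_covarianceBilin.isSymm
      isPosSemidef_covarianceBilin.isSymm fun x ↦ ?_
    simp only [ContinuousLinearMap.toBilinForm_apply]
    rw [PiLp.coe_symm_continuousLinearEquiv, covarianceBilin_apply_pi, covarianceBilin_apply_pi]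
    · congrm ∑ i, ∑ j, _ * ?_
      rw [BrownianReal.covariance_eval_projectiveFamily, covariance_map]
      · wlog hij : i.1 ≤ j.1 generalizing i j
        · rw [covariance_comm, this j i (by grind), min_comm]
        rw [min_eq_left hij]
        exact hcov i j hij
      any_goals exact Measurable.aestronglyMeasurable (by fun_prop)
      exact aemeasurable_pi_lambda _ hm
    · exact fun i ↦ (IsGaussian.hasGaussianLaw_id.eval i).memLp_two
    · exact fun i ↦ (hG.isGaussian_map.hasGaussianLaw_id.eval i).memLp_two

end GaussianSpace

/-! ### Gaussian processes, Brownian motion and elementary integrals -/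

section GaussianProcess

variable {Ω : Type*} [MeasurableSpace Ω] {P : Measure Ω}

/-- A finite index set splits into its two sides; the two independent Gaussian vectors are jointly
Gaussian, and `L` only relabels coordinates. -/
lemma isGaussianProcess_sumElim {S T : Type*} {X : S → Ω → ℝ} {Y : T → Ω → ℝ}
    (hX : IsGaussianProcess X P) (hY : IsGaussianProcess Y P)
    (h : IndepFun (fun ω s ↦ X s ω) (fun ω t ↦ Y t ω) P) :
    IsGaussianProcess (Sum.elim X Y) P where
  hasGaussianLaw I := by
    have hind : IndepFun (fun ω ↦ I.toLeft.restrict (X · ω)) (fun ω ↦ I.toRight.restrict (Y · ω)) P :=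
      h.comp (Finset.measurable_restrict I.toLeft) (Finset.measurable_restrict I.toRight)
    have hG := hind.hasGaussianLaw (hX.hasGaussianLaw _) (hY.hasGaussianLaw _)
    let L : ((I.toLeft → ℝ) × (I.toRight → ℝ)) →L[ℝ] (I → ℝ) := ContinuousLinearMap.pi fun i ↦
      match i with
      | ⟨.inl s, hs⟩ => (ContinuousLinearMap.proj ⟨s, by simpa using hs⟩).comp
          (ContinuousLinearMap.fst ℝ _ _)
      | ⟨.inr t, ht⟩ => (ContinuousLinearMap.proj ⟨t, by simpa using ht⟩).comp
          (ContinuousLinearMap.snd ℝ _ _)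
    have e : (fun ω ↦ I.restrict (Sum.elim X Y · ω)) =
        L ∘ fun ω ↦ (I.toLeft.restrict (X · ω), I.toRight.restrict (Y · ω)) := by
      funext ω ⟨i, hi⟩
      rcases i with s | t <;> rfl
    rw [e]
    exact hG.map L

lemma isGaussianProcess_const {ι : Type*} [Unique ι] {Y : Ω → ℝ} (hY : HasGaussianLaw Y P) :
    IsGaussianProcess (fun (_ : ι) ↦ Y) P where
  hasGaussianLaw I := by
    let L : ℝ →L[ℝ] (I → ℝ) := ContinuousLinearMap.pi fun _ ↦ ContinuousLinearMap.id ℝ ℝ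
    exact hY.map L

namespace IsBrownianOn

variable {T : ℝ} {W : ℝ → Ω → ℝ}

lemma isGaussianProcess (hW : IsBrownianOn P T W) :
    IsGaussianProcess (fun (t : Icc (0 : ℝ) T) ω ↦ W t ω) P where
  hasGaussianLaw I := by
    classical
    let J : Finset NNReal := I.image fun t : Icc (0 : ℝ) T ↦ Real.toNNReal t
    have hJ : ∀ t ∈ J, (t : ℝ) ≤ T := by
      intro t ht
      obtain ⟨s, -, rfl⟩ := Finset.mem_image.1 ht
      rw [Real.coe_toNNReal _ s.2.1]
      exact s.2.2
    let L : (J → ℝ) →L[ℝ] (I → ℝ) := ContinuousLinearMap.pi fun i ↦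
      ContinuousLinearMap.proj ⟨Real.toNNReal i.1, Finset.mem_image_of_mem _ i.2⟩
    have e : (fun ω ↦ I.restrict fun t : Icc (0 : ℝ) T ↦ W t ω) =
        L ∘ fun ω (t : J) ↦ W ((t : NNReal) : ℝ) ω := by
      funext ω i
      simp [L, Real.coe_toNNReal _ i.1.2.1]
    rw [e]
    exact (hW.hasLaw J hJ).hasGaussianLaw.map L

lemma hasGaussianLaw_eval (hW : IsBrownianOn P T W) {t : ℝ} (ht : t ∈ Icc 0 T) :
    HasGaussianLaw (W t) P :=
  hW.isGaussianProcess.hasGaussianLaw_eval ⟨t, ht⟩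

lemma integral_eval (hW : IsBrownianOn P T W) {t : ℝ} (ht : t ∈ Icc 0 T) :
    ∫ ω, W t ω ∂P = 0 := by
  lift t to NNReal using ht.1
  have h := hW.hasLaw {t} (by simpa using ht.2)
  have := (BrownianReal.measurePreserving_eval_projectiveFamily ⟨t, by simp⟩).hasLaw.comp h
  exact this.integral_eq.trans integral_id_gaussianReal

lemma integral_mul (hW : IsBrownianOn P T W) {s t : ℝ} (hs : s ∈ Icc 0 T) (ht : t ∈ Icc 0 T) :
    ∫ ω, W s ω * W t ω ∂P = min s t := by
  have := hW.isGaussianProcess.isProbabilityMeasure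
  have hc : cov[W s, W t; P] = min s t := by
    lift s to NNReal using hs.1
    lift t to NNReal using ht.1
    convert (hW.hasLaw {s, t} (by simpa using ⟨hs.2, ht.2⟩)).covariance_fun_comp
      (f := Function.eval ⟨s, by simp⟩) (g := fun x ↦ x ⟨t, by simp⟩) ?_ ?_
    · simp [BrownianReal.covariance_eval_projectiveFamily]
    all_goals exact Measurable.aemeasurable (by fun_prop)
  rw [covariance_eq_sub (hW.hasGaussianLaw_eval hs).memLp_two
    (hW.hasGaussianLaw_eval ht).memLp_two, hW.integral_eval hs, zero_mul, sub_zero] at hc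
  exact hc

end IsBrownianOn

lemma tendsto_Lp_of_ae_eq {α : Type*} [MeasurableSpace α] {μ : Measure α} {u : ℕ → Lp ℝ 2 μ}
    {Z : Lp ℝ 2 μ} {U : ℕ → α → ℝ} {Y : α → ℝ} (hu : ∀ n, u n =ᵐ[μ] U n) (hZ : Z =ᵐ[μ] Y)
    (h : Tendsto (fun n ↦ eLpNorm (fun a ↦ U n a - Y a) 2 μ) atTop (𝓝 0)) :
    Tendsto u atTop (𝓝 Z) := by
  rw [Lp.tendsto_Lp_iff_tendsto_eLpNorm']
  refine h.congr fun n ↦ eLpNorm_congr_ae ?_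
  filter_upwards [hu n, hZ] with a h1 h2
  simp [h1, h2]

namespace StepIntegrand

/-- The elementary integral of a step function with respect to a vector-valued function. -/
noncomputable def sum {E : Type*} [AddCommGroup E] [Module ℝ E] {t : ℝ} (f : StepIntegrand t)
    (w : ℝ → E) : E :=
  ∑ i : Fin f.n, f.coeff i • (w (f.node i.succ) - w (f.node i.castSucc))

/-- The elementary Itô isometry: by bilinearity, inner products of elementary integrals depend only
on those of the integrators. It is applied to Brownian motion in `L²(P)` and to `a ↦ 𝟙_(0, a]` in
`L²((0, T])`, both with inner products `min a b`. -/
lemma inner_sum_eq {E F : Type*} [NormedAddCommGroup E] [InnerProductSpace ℝ E]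
    [NormedAddCommGroup F] [InnerProductSpace ℝ F] {s t T : ℝ} (hs : s ≤ T) (ht : t ≤ T)
    {w : ℝ → E} {e : ℝ → F}
    (h : ∀ a ∈ Icc 0 T, ∀ b ∈ Icc 0 T, inner ℝ (w a) (w b) = inner ℝ (e a) (e b))
    (f : StepIntegrand s) (g : StepIntegrand t) :
    inner ℝ (f.sum w) (g.sum w) = inner ℝ (f.sum e) (g.sum e) := by
  have hf : ∀ i, f.node i ∈ Icc 0 T := fun i ↦ ⟨(f.node_mem i).1, (f.node_mem i).2.trans hs⟩
  have hg : ∀ i, g.node i ∈ Icc 0 T := fun i ↦ ⟨(g.node_mem i).1, (g.node_mem i).2.trans ht⟩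
  simp only [StepIntegrand.sum, sum_inner, inner_sum, inner_smul_left, inner_smul_right,
    inner_sub_left, inner_sub_right, h _ (hf _) _ (hg _)]

lemma inner_sum_eq_zero {E : Type*} [NormedAddCommGroup E] [InnerProductSpace ℝ E] {t T : ℝ}
    (ht : t ≤ T) {w : ℝ → E} {z : E} (h : ∀ a ∈ Icc 0 T, inner ℝ (w a) z = 0)
    (f : StepIntegrand t) : inner ℝ (f.sum w) z = 0 := by
  have hf : ∀ i, f.node i ∈ Icc 0 T := fun i ↦ ⟨(f.node_mem i).1, (f.node_mem i).2.trans ht⟩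
  simp [StepIntegrand.sum, sum_inner, inner_smul_left, inner_sub_left, h _ (hf _)]

lemma sum_mem {E : Type*} [AddCommGroup E] [Module ℝ E] {t T : ℝ} (ht : t ≤ T) {w : ℝ → E}
    {S : Submodule ℝ E} (h : ∀ a ∈ Icc 0 T, w a ∈ S) (f : StepIntegrand t) : f.sum w ∈ S := by
  have hf : ∀ i, f.node i ∈ Icc 0 T := fun i ↦ ⟨(f.node_mem i).1, (f.node_mem i).2.trans ht⟩
  exact Submodule.sum_mem _ fun i _ ↦ S.smul_mem _ (S.sub_mem (h _ (hf _)) (h _ (hf _)))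

lemma coeFn_sum {α : Type*} [MeasurableSpace α] {μ : Measure α} {t T : ℝ} (ht : t ≤ T)
    {w : ℝ → Lp ℝ 2 μ} {W : ℝ → α → ℝ} (h : ∀ a ∈ Icc 0 T, w a =ᵐ[μ] W a) (f : StepIntegrand t) :
    ⇑(f.sum w : Lp ℝ 2 μ) =ᵐ[μ] f.integral W := by
  have hf : ∀ i, f.node i ∈ Icc 0 T := fun i ↦ ⟨(f.node_mem i).1, (f.node_mem i).2.trans ht⟩
  have hs := coeFn_sum_smul Finset.univ f.coeff
    fun i ↦ w (f.node i.succ) - w (f.node i.castSucc)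
  filter_upwards [hs, ae_all_iff.2 fun i ↦ h _ (hf i),
    ae_all_iff.2 fun i : Fin f.n ↦ Lp.coeFn_sub (w (f.node i.succ)) (w (f.node i.castSucc))]
    with a h1 h2 h3
  rw [StepIntegrand.sum, h1, StepIntegrand.integral]
  refine Finset.sum_congr rfl fun i _ ↦ ?_
  rw [h3, Pi.sub_apply, h2, h2]

/-- A step function is its own elementary integral against `a ↦ 𝟙_(0, a]`, so `coeFn_sum` serves
both sides of the isometry. -/
lemma eval_eq {t : ℝ} (f : StepIntegrand t) (s : ℝ) :
    f.eval s = f.integral (fun a r ↦ (Ioc 0 a).indicator (fun _ ↦ (1 : ℝ)) r) s := by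
  refine Finset.sum_congr rfl fun i _ ↦ ?_
  have h1 : f.node i.castSucc ≤ f.node i.succ := f.node_mono (Fin.castSucc_le_succ i)
  have h0 := (f.node_mem i.castSucc).1
  simp only [indicator_apply, mem_Ioc]
  split_ifs <;> grind

lemma eval_eq_zero {t s : ℝ} (f : StepIntegrand t) (hs : s ∉ Ioc 0 t) : f.eval s = 0 := by
  refine Finset.sum_eq_zero fun i _ ↦ indicator_of_notMem (fun h ↦ hs ?_) _
  exact ⟨(f.node_mem _).1.trans_lt h.1, h.2.trans (f.node_mem _).2⟩

end StepIntegrand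

end GaussianProcess

/-! ### Wiener integrals and their covariances -/

section Wiener

variable {Ω : Type*} [MeasurableSpace Ω] {P : Measure Ω} {T : ℝ} {σ : ℝ → ℝ}

lemma memLp_indicator_one (T a : ℝ) :
    MemLp ((Ioc 0 a).indicator fun _ ↦ (1 : ℝ)) 2 (volume.restrict (Ioc 0 T)) :=
  (memLp_const (1 : ℝ)).indicator measurableSet_Ioc

/-- The indicator function of `(0, a]` in `L²((0, T])`. -/
noncomputable def indicatorL2 (T a : ℝ) : Lp ℝ 2 (volume.restrict (Ioc (0 : ℝ) T)) :=
  (memLp_indicator_one T a).toLp _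

lemma inner_indicator_toLp (hσ : MemLp σ 2 (volume.restrict (Ioc 0 T))) {s t : ℝ}
    (hs : s ∈ Icc 0 T) (ht : t ∈ Icc 0 T) :
    inner ℝ ((hσ.indicator (s := Ioc 0 s) measurableSet_Ioc).toLp _)
      ((hσ.indicator (s := Ioc 0 t) measurableSet_Ioc).toLp _) =
      ∫ r in (0 : ℝ)..min s t, σ r ^ 2 := by
  rw [inner_toLp, intervalIntegral.integral_of_le (le_min hs.1 ht.1)]
  have e : (fun r ↦ (Ioc 0 s).indicator σ r * (Ioc 0 t).indicator σ r) =
      (Ioc 0 (min s t)).indicator fun r ↦ σ r ^ 2 := by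
    funext r
    simp only [indicator_apply, mem_Ioc, le_min_iff]
    split_ifs <;> grind
  rw [e, integral_indicator measurableSet_Ioc, Measure.restrict_restrict measurableSet_Ioc,
    inter_eq_left.2 (Ioc_subset_Ioc_right ((min_le_left _ _).trans hs.2))]

lemma inner_indicatorL2 {s t : ℝ} (hs : s ∈ Icc 0 T) (ht : t ∈ Icc 0 T) :
    inner ℝ (indicatorL2 T s) (indicatorL2 T t) = min s t := by
  have := inner_indicator_toLp (σ := fun _ ↦ 1) (memLp_const (1 : ℝ)) hs ht
  simpa [indicatorL2] using this

namespace IsWienerIntegral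

variable {W : ℝ → Ω → ℝ} {w : ℝ → Lp ℝ 2 P}

/-- One sequence of step functions approximates on both sides of the isometry. Cutting `σ` off after
`t` places integrals with different endpoints in the same space `L²((0, T])`. -/
lemma exists_tendsto (hσ : MemLp σ 2 (volume.restrict (Ioc 0 T)))
    (hw : ∀ a ∈ Icc 0 T, w a =ᵐ[P] W a) {t : ℝ} (ht : t ∈ Icc 0 T) {Y : Ω → ℝ} {y : Lp ℝ 2 P}
    (hy : y =ᵐ[P] Y) (hY : IsWienerIntegral P W σ t Y) :
    ∃ f : ℕ → StepIntegrand t, Tendsto (fun k ↦ (f k).sum w) atTop (𝓝 y) ∧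
      Tendsto (fun k ↦ (f k).sum (indicatorL2 T)) atTop
        (𝓝 ((hσ.indicator (s := Ioc 0 t) measurableSet_Ioc).toLp _)) := by
  obtain ⟨-, f, hf1, hf2⟩ := hY
  refine ⟨f, tendsto_Lp_of_ae_eq (fun k ↦ (f k).coeFn_sum ht.2 hw) hy hf2,
    tendsto_Lp_of_ae_eq (U := fun k ↦ (f k).eval) (fun k ↦ ?_) (MemLp.coeFn_toLp _) ?_⟩
  · rw [show (f k).eval = (f k).integral fun a r ↦ (Ioc 0 a).indicator (fun _ ↦ (1 : ℝ)) r from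
      funext (f k).eval_eq]
    exact (f k).coeFn_sum ht.2 fun a _ ↦ (memLp_indicator_one T a).coeFn_toLp
  · refine hf1.congr fun k ↦ ?_
    have e : (fun a ↦ (f k).eval a - (Ioc 0 t).indicator σ a) =
        (Ioc 0 t).indicator fun a ↦ (f k).eval a - σ a := by
      funext a
      by_cases ha : a ∈ Ioc 0 t
      · simp [ha]
      · rw [indicator_of_notMem ha, indicator_of_notMem ha, (f k).eval_eq_zero ha, sub_zero]
    rw [e, eLpNorm_indicator_eq_eLpNorm_restrict measurableSet_Ioc,
      Measure.restrict_restrict measurableSet_Ioc, inter_eq_left.2 (Ioc_subset_Ioc_right ht.2)]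

/-- The Itô isometry. -/
lemma inner_eq (hσ : MemLp σ 2 (volume.restrict (Ioc 0 T)))
    (hw : ∀ a ∈ Icc 0 T, w a =ᵐ[P] W a)
    (hin : ∀ a ∈ Icc 0 T, ∀ b ∈ Icc 0 T, inner ℝ (w a) (w b) = min a b)
    {s t : ℝ} (hs : s ∈ Icc 0 T) (ht : t ∈ Icc 0 T) {X Y : Ω → ℝ} {x y : Lp ℝ 2 P}
    (hx : x =ᵐ[P] X) (hy : y =ᵐ[P] Y)
    (hX : IsWienerIntegral P W σ s X) (hY : IsWienerIntegral P W σ t Y) :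
    inner ℝ x y = ∫ r in (0 : ℝ)..min s t, σ r ^ 2 := by
  obtain ⟨f, hf, hf'⟩ := hX.exists_tendsto hσ hw hs hx
  obtain ⟨g, hg, hg'⟩ := hY.exists_tendsto hσ hw ht hy
  rw [← inner_indicator_toLp hσ hs ht]
  refine tendsto_nhds_unique (hf.inner hg) ((hf'.inner hg').congr fun k ↦ ?_)
  exact (StepIntegrand.inner_sum_eq hs.2 ht.2 (fun a ha b hb ↦ by
    rw [hin a ha b hb, inner_indicatorL2 ha hb]) _ _).symm

lemma inner_eq_zero (hσ : MemLp σ 2 (volume.restrict (Ioc 0 T)))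
    (hw : ∀ a ∈ Icc 0 T, w a =ᵐ[P] W a) {z : Lp ℝ 2 P}
    (hz : ∀ a ∈ Icc 0 T, inner ℝ (w a) z = 0)
    {t : ℝ} (ht : t ∈ Icc 0 T) {Y : Ω → ℝ} {y : Lp ℝ 2 P} (hy : y =ᵐ[P] Y)
    (hY : IsWienerIntegral P W σ t Y) : inner ℝ y z = 0 := by
  obtain ⟨f, hf, -⟩ := hY.exists_tendsto hσ hw ht hy
  refine tendsto_nhds_unique (hf.inner tendsto_const_nhds) ?_
  simp [StepIntegrand.inner_sum_eq_zero ht.2 hz]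

lemma mem_topologicalClosure (hσ : MemLp σ 2 (volume.restrict (Ioc 0 T)))
    (hw : ∀ a ∈ Icc 0 T, w a =ᵐ[P] W a) {S : Submodule ℝ (Lp ℝ 2 P)}
    (hS : ∀ a ∈ Icc 0 T, w a ∈ S) {t : ℝ} (ht : t ∈ Icc 0 T) {Y : Ω → ℝ} {y : Lp ℝ 2 P}
    (hy : y =ᵐ[P] Y) (hY : IsWienerIntegral P W σ t Y) : y ∈ S.topologicalClosure := by
  obtain ⟨f, hf, -⟩ := hY.exists_tendsto hσ hw ht hy
  exact mem_closure_of_tendsto hf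
    (Eventually.of_forall fun k ↦ StepIntegrand.sum_mem ht.2 hS (f k))

end IsWienerIntegral

lemma integral_mul_eq_zero_of_indepFun {X Y : Ω → ℝ} (h : IndepFun X Y P)
    (hX : AEStronglyMeasurable X P) (hY : AEStronglyMeasurable Y P) (hX0 : ∫ ω, X ω ∂P = 0) :
    ∫ ω, X ω * Y ω ∂P = 0 := by
  have := h.integral_mul_eq_mul_integral hX hY
  rw [hX0, zero_mul] at this
  exact this

/-- The classes in `L²(P)` of a Brownian motion `W` and of an independent Wiener integral process
`V` with variance function `v`. -/
structure IsWienerPair (P : Measure Ω) (T : ℝ) (v : ℝ → ℝ) (S : Submodule ℝ (Lp ℝ 2 P))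
    (w x : ℝ → Lp ℝ 2 P) : Prop where
  isGaussianSpace : IsGaussianSpace S
  isClosed : IsClosed (S : Set (Lp ℝ 2 P))
  left_mem : ∀ t ∈ Icc 0 T, w t ∈ S
  right_mem : ∀ t ∈ Icc 0 T, x t ∈ S
  inner_left : ∀ s ∈ Icc 0 T, ∀ t ∈ Icc 0 T, s ≤ t → inner ℝ (w s) (w t) = s
  inner_right : ∀ s ∈ Icc 0 T, ∀ t ∈ Icc 0 T, s ≤ t → inner ℝ (x s) (x t) = v s
  inner_left_right : ∀ s ∈ Icc 0 T, ∀ t ∈ Icc 0 T, inner ℝ (w s) (x t) = 0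

/-- Independence makes `W₁`, `W₂`, `V 0` jointly Gaussian and mutually orthogonal. The space `S` is
their closed span; it contains the Wiener integrals, whose covariances come from the isometry. -/
lemma exists_isWienerPair [IsProbabilityMeasure P] {W₁ W₂ V : ℝ → Ω → ℝ} {v₀ : NNReal}
    (hW₁ : IsBrownianOn P T W₁) (hW₂ : IsBrownianOn P T W₂)
    (hW : IndepFun (fun ω (t : Icc (0 : ℝ) T) ↦ W₁ t ω) (fun ω (t : Icc (0 : ℝ) T) ↦ W₂ t ω) P)
    (hWV : IndepFun (fun ω (t : Icc (0 : ℝ) T) ↦ (W₁ t ω, W₂ t ω)) (V 0) P)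
    (hV₀ : HasLaw (V 0) (gaussianReal 0 v₀) P)
    (hσ : MemLp σ 2 (volume.restrict (Ioc 0 T)))
    (hV : ∀ t ∈ Icc 0 T, IsWienerIntegral P W₁ σ t (fun ω ↦ V t ω - V 0 ω)) :
    (∃ S w x, IsWienerPair P T (fun t ↦ Var[V t; P]) S w x ∧ (∀ t ∈ Icc 0 T, w t =ᵐ[P] W₂ t) ∧
      ∀ t ∈ Icc 0 T, x t =ᵐ[P] V t) ∧
    ∀ t ∈ Icc 0 T, Var[V t; P] = v₀ + ∫ r in (0 : ℝ)..t, σ r ^ 2 := by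
  classical
  have hV0 : MemLp (V 0) 2 P := hV₀.hasGaussianLaw.memLp_two
  have hV0' : ∫ ω, V 0 ω ∂P = 0 := hV₀.integral_eq.trans integral_id_gaussianReal
  have hm : ∀ (W : ℝ → Ω → ℝ), IsBrownianOn P T W → ∃ w : ℝ → Lp ℝ 2 P,
      ∀ t ∈ Icc 0 T, w t =ᵐ[P] W t := fun W hW ↦ by
    -- Nothing is known about `W` outside `[0, T]`, so the classes there are set to `0`.
    refine ⟨fun t ↦ if ht : t ∈ Icc 0 T then (hW.hasGaussianLaw_eval ht).memLp_two.toLp _ else 0,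
      fun t ht ↦ ?_⟩
    simp only [dif_pos ht]
    exact MemLp.coeFn_toLp _
  obtain ⟨w₁, hw₁⟩ := hm W₁ hW₁
  obtain ⟨w, hw⟩ := hm W₂ hW₂
  obtain ⟨ξ, hξ⟩ : ∃ ξ : Lp ℝ 2 P, ξ =ᵐ[P] V 0 := ⟨hV0.toLp _, hV0.coeFn_toLp⟩
  obtain ⟨y, hy⟩ : ∃ y : ℝ → Lp ℝ 2 P, ∀ t ∈ Icc 0 T, y t =ᵐ[P] fun ω ↦ V t ω - V 0 ω := by
    refine ⟨fun t ↦ if ht : t ∈ Icc 0 T then (hV t ht).1.toLp _ else 0, fun t ht ↦ ?_⟩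
    simp only [dif_pos ht]
    exact MemLp.coeFn_toLp _
  have hin : ∀ {A B : Lp ℝ 2 P} {X Y : Ω → ℝ}, A =ᵐ[P] X → B =ᵐ[P] Y →
      inner ℝ A B = ∫ ω, X ω * Y ω ∂P := fun {A B X Y} hA hB ↦ by
    rw [L2.inner_def]
    refine integral_congr_ae ?_
    filter_upwards [hA, hB] with ω h1 h2
    simp [h1, h2, mul_comm]
  -- covariances
  have hw₁w₁ : ∀ a ∈ Icc 0 T, ∀ b ∈ Icc 0 T, inner ℝ (w₁ a) (w₁ b) = min a b := fun a ha b hb ↦ by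
    rw [hin (hw₁ a ha) (hw₁ b hb), hW₁.integral_mul ha hb]
  have hww : ∀ a ∈ Icc 0 T, ∀ b ∈ Icc 0 T, inner ℝ (w a) (w b) = min a b := fun a ha b hb ↦ by
    rw [hin (hw a ha) (hw b hb), hW₂.integral_mul ha hb]
  have hw₁w : ∀ b ∈ Icc 0 T, ∀ a ∈ Icc 0 T, inner ℝ (w₁ a) (w b) = 0 := fun b hb a ha ↦ by
    rw [hin (hw₁ a ha) (hw b hb)]
    exact integral_mul_eq_zero_of_indepFun
      (hW.comp (measurable_pi_apply (⟨a, ha⟩ : Icc 0 T)) (measurable_pi_apply (⟨b, hb⟩ : Icc 0 T)))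
      (hW₁.hasGaussianLaw_eval ha).aemeasurable.aestronglyMeasurable
      (hW₂.hasGaussianLaw_eval hb).aemeasurable.aestronglyMeasurable (hW₁.integral_eval ha)
  have hw₁ξ : ∀ a ∈ Icc 0 T, inner ℝ (w₁ a) ξ = 0 := fun a ha ↦ by
    rw [hin (hw₁ a ha) hξ]
    exact integral_mul_eq_zero_of_indepFun
      (hWV.comp (measurable_fst.comp (measurable_pi_apply (⟨a, ha⟩ : Icc 0 T))) measurable_id)
      (hW₁.hasGaussianLaw_eval ha).aemeasurable.aestronglyMeasurable hV0.1 (hW₁.integral_eval ha)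
  have hwξ : ∀ a ∈ Icc 0 T, inner ℝ (w a) ξ = 0 := fun a ha ↦ by
    rw [hin (hw a ha) hξ]
    exact integral_mul_eq_zero_of_indepFun
      (hWV.comp (measurable_snd.comp (measurable_pi_apply (⟨a, ha⟩ : Icc 0 T))) measurable_id)
      (hW₂.hasGaussianLaw_eval ha).aemeasurable.aestronglyMeasurable hV0.1 (hW₂.integral_eval ha)
  have hξξ : inner ℝ ξ ξ = (v₀ : ℝ) := by
    have := hV₀.variance_eq
    rw [variance_id_gaussianReal, variance_of_integral_eq_zero hV0.1.aemeasurable hV0'] at this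
    rw [hin hξ hξ, ← this]
    simp_rw [pow_two]
  have hyy : ∀ s ∈ Icc 0 T, ∀ t ∈ Icc 0 T,
      inner ℝ (y s) (y t) = ∫ r in (0 : ℝ)..min s t, σ r ^ 2 := fun s hs t ht ↦
    IsWienerIntegral.inner_eq hσ hw₁ hw₁w₁ hs ht (hy s hs) (hy t ht) (hV s hs) (hV t ht)
  have hyξ : ∀ t ∈ Icc 0 T, inner ℝ (y t) ξ = 0 := fun t ht ↦
    (hV t ht).inner_eq_zero hσ hw₁ hw₁ξ ht (hy t ht)
  have hyw : ∀ s ∈ Icc 0 T, ∀ t ∈ Icc 0 T, inner ℝ (y t) (w s) = 0 := fun s hs t ht ↦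
    (hV t ht).inner_eq_zero hσ hw₁ (hw₁w s hs) ht (hy t ht)
  -- the Gaussian space
  let X : (Icc (0 : ℝ) T ⊕ Icc (0 : ℝ) T) ⊕ Unit → Lp ℝ 2 P :=
    Sum.elim (Sum.elim (fun t ↦ w₁ t) (fun t ↦ w t)) fun _ ↦ ξ
  have hG : IsGaussianProcess (Sum.elim (Sum.elim (fun (t : Icc (0 : ℝ) T) ↦ W₁ t)
      (fun (t : Icc (0 : ℝ) T) ↦ W₂ t)) fun _ : Unit ↦ V 0) P := by
    refine isGaussianProcess_sumElim
      (isGaussianProcess_sumElim hW₁.isGaussianProcess hW₂.isGaussianProcess hW)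
      (isGaussianProcess_const hV₀.hasGaussianLaw) ?_
    refine hWV.comp (φ := fun p s ↦ Sum.elim (fun t ↦ (p t).1) (fun t ↦ (p t).2) s)
      (ψ := fun a _ ↦ a) ?_ (by fun_prop) |>.congr ?_ ?_
    · refine measurable_pi_iff.2 fun s ↦ ?_
      rcases s with s | s <;> simp only [Sum.elim_inl, Sum.elim_inr] <;> fun_prop
    · refine Eventually.of_forall fun ω ↦ ?_
      funext s
      rcases s with s | s <;> rfl
    · exact Eventually.of_forall fun ω ↦ rfl
  have hXae : ∀ i, Sum.elim (Sum.elim (fun (t : Icc (0 : ℝ) T) ↦ W₁ t)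
      (fun (t : Icc (0 : ℝ) T) ↦ W₂ t)) (fun _ : Unit ↦ V 0) i =ᵐ[P] X i := by
    rintro ((t | t) | _)
    · exact (hw₁ t t.2).symm
    · exact (hw t t.2).symm
    · exact hξ.symm
  have hS : IsGaussianSpace (Submodule.span ℝ (range X)) := by
    refine isGaussianSpace_span (hG.congr hXae) ?_
    rintro ((t | t) | _)
    · exact (integral_congr_ae (hw₁ t t.2)).trans (hW₁.integral_eval t.2)
    · exact (integral_congr_ae (hw t t.2)).trans (hW₂.integral_eval t.2)
    · exact (integral_congr_ae hξ).trans hV0'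
  set S := (Submodule.span ℝ (range X)).topologicalClosure with hSdef
  have hmem : ∀ i, X i ∈ Submodule.span ℝ (range X) := fun i ↦ Submodule.subset_span ⟨i, rfl⟩
  have hle := (Submodule.span ℝ (range X)).le_topologicalClosure
  have hx : ∀ t ∈ Icc 0 T, ⇑(y t + ξ) =ᵐ[P] V t := fun t ht ↦ by
    filter_upwards [hy t ht, hξ, Lp.coeFn_add (y t) ξ] with ω h1 h2 h3
    rw [h3, Pi.add_apply, h1, h2, sub_add_cancel]
  have hmem_x : ∀ t ∈ Icc 0 T, y t + ξ ∈ S := fun t ht ↦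
    S.add_mem ((hV t ht).mem_topologicalClosure hσ hw₁ (fun a ha ↦ hmem (.inl (.inl ⟨a, ha⟩))) ht
      (hy t ht)) (hle (hmem (.inr ())))
  have hGS : IsGaussianSpace S := hS.topologicalClosure
  have hxx : ∀ s ∈ Icc 0 T, ∀ t ∈ Icc 0 T,
      inner ℝ (y s + ξ) (y t + ξ) = v₀ + ∫ r in (0 : ℝ)..min s t, σ r ^ 2 := fun s hs t ht ↦ by
    rw [inner_add_left, inner_add_right, inner_add_right, hyy s hs t ht, hyξ s hs,
      real_inner_comm, hyξ t ht, hξξ]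
    ring
  have hvar : ∀ t ∈ Icc 0 T, Var[V t; P] = v₀ + ∫ r in (0 : ℝ)..t, σ r ^ 2 := fun t ht ↦ by
    rw [← variance_congr (hx t ht), variance_Lp (hGS.integral_eq_zero (hmem_x t ht)),
      ← real_inner_self_eq_norm_sq, hxx t ht t ht, min_self]
  refine ⟨⟨S, w, fun t ↦ y t + ξ, ⟨hGS, Submodule.isClosed_topologicalClosure _,
    fun t ht ↦ hle (hmem (.inl (.inr ⟨t, ht⟩))), hmem_x, fun s hs t ht hst ↦ ?_,
    fun s hs t ht hst ↦ ?_, fun s hs t ht ↦ ?_⟩, hw, hx⟩, hvar⟩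
  · rw [hww s hs t ht, min_eq_left hst]
  · rw [hxx s hs t ht, min_eq_left hst, hvar s hs]
  · rw [inner_add_right, hwξ s hs, real_inner_comm, hyw s hs t ht, add_zero]

end Wiener

/-! ### Riemann sums and integrals in `L²` -/

section RiemannSum

variable {E : Type*} [NormedAddCommGroup E] [NormedSpace ℝ E]

/-- The left Riemann sum of `∫₀ᵗ g s • x s ds`, with the weight `g` integrated exactly. -/
noncomputable def leftRiemannSum (g : ℝ → ℝ) (x : ℝ → E) (t : ℝ) (n : ℕ) : E :=
  ∑ k ∈ Finset.range (n + 1),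
    (∫ s in (t * k / (n + 1))..(t * (k + 1 : ℕ) / (n + 1)), g s) • x (t * k / (n + 1))

lemma mul_div_mem_Icc {t : ℝ} (ht : 0 ≤ t) {n k : ℕ} (hk : k ≤ n + 1) :
    t * k / (n + 1) ∈ Icc 0 t := by
  have hk' : (k : ℝ) ≤ n + 1 := by exact_mod_cast hk
  have hn : (0 : ℝ) < n + 1 := by positivity
  refine ⟨by positivity, ?_⟩
  rw [div_le_iff₀ hn]
  exact mul_le_mul_of_nonneg_left hk' ht

/-- Only `x` is sampled, so its uniform continuity suffices and `g` need only be integrable; this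
matters since `ψ'` may be unbounded near `0`. -/
lemma tendsto_leftRiemannSum [CompleteSpace E] {g : ℝ → ℝ} {x : ℝ → E} {t : ℝ} (ht : 0 ≤ t)
    (hg : IntervalIntegrable g volume 0 t) (hx : ContinuousOn x (Icc 0 t)) :
    Tendsto (leftRiemannSum g x t) atTop (𝓝 (∫ s in (0 : ℝ)..t, g s • x s)) := by
  have hgx : IntervalIntegrable (fun s ↦ g s • x s) volume 0 t :=
    hg.smul_continuousOn (by rwa [uIcc_of_le ht])
  set C := ∫ s in (0 : ℝ)..t, ‖g s‖ with hC
  have hC0 : 0 ≤ C := intervalIntegral.integral_nonneg ht fun s _ ↦ norm_nonneg _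
  rw [Metric.tendsto_atTop]
  intro ε hε
  have huc := isCompact_Icc.uniformContinuousOn_of_continuous hx
  obtain ⟨δ, hδ, hxδ⟩ := Metric.uniformContinuousOn_iff.1 huc (ε / (C + 1)) (by positivity)
  obtain ⟨N, hN⟩ := exists_nat_gt (t / δ)
  refine ⟨N, fun n hn ↦ ?_⟩
  have hn0 : (0 : ℝ) < n + 1 := by positivity
  have hmesh : t / (n + 1) < δ := by
    rw [div_lt_iff₀ hδ] at hN
    rw [div_lt_iff₀ hn0]
    have : (N : ℝ) ≤ n := by exact_mod_cast hn
    nlinarith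
  set a : ℕ → ℝ := fun k ↦ t * k / (n + 1) with ha
  have hmem : ∀ k ≤ n + 1, a k ∈ Icc 0 t := fun k hk ↦ mul_div_mem_Icc ht hk
  have hmono : ∀ k, a k ≤ a (k + 1) := fun k ↦ by
    simp only [ha]
    push_cast
    gcongr
    linarith
  have hstep : ∀ k, a (k + 1) - a k = t / (n + 1) := fun k ↦ by
    simp only [ha]
    push_cast
    field_simp
    ring
  have hsub : ∀ {k}, k < n + 1 → uIcc (a k) (a (k + 1)) ⊆ uIcc 0 t := fun {k} hk ↦ by
    rw [uIcc_of_le (hmono k), uIcc_of_le ht]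
    exact Icc_subset_Icc (hmem k hk.le).1 (hmem (k + 1) hk).2
  have ha0 : a 0 = 0 := by simp [ha]
  have haN : a (n + 1) = t := by
    simp only [ha]
    push_cast
    field_simp
  have e1 : ∫ s in (0 : ℝ)..t, g s • x s =
      ∑ k ∈ Finset.range (n + 1), ∫ s in a k..a (k + 1), g s • x s := by
    rw [intervalIntegral.sum_integral_adjacent_intervals (a := a)
      fun k hk ↦ hgx.mono_set (hsub hk), ha0, haN]
  have e2 : C = ∑ k ∈ Finset.range (n + 1), ∫ s in a k..a (k + 1), ‖g s‖ := by
    rw [intervalIntegral.sum_integral_adjacent_intervals (a := a)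
      fun k hk ↦ hg.norm.mono_set (hsub hk), ha0,
      haN]
  have hterm : ∀ k ∈ Finset.range (n + 1),
      ‖(∫ s in a k..a (k + 1), g s) • x (a k) - ∫ s in a k..a (k + 1), g s • x s‖ ≤
        (∫ s in a k..a (k + 1), ‖g s‖) * (ε / (C + 1)) := by
    intro k hk
    rw [Finset.mem_range] at hk
    have hgk := hg.mono_set (hsub hk)
    rw [← intervalIntegral.integral_smul_const, ← intervalIntegral.integral_sub
      (hgk.smul_continuousOn continuousOn_const) (hgx.mono_set (hsub hk)), ← intervalIntegral.integral_mul_const]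
    refine intervalIntegral.norm_integral_le_of_norm_le (hmono k)
      (Eventually.of_forall fun s hs ↦ ?_) (hgk.norm.mul_const _)
    rw [← smul_sub, norm_smul]
    refine mul_le_mul_of_nonneg_left ?_ (norm_nonneg _)
    rw [← dist_eq_norm]
    refine (hxδ _ (hmem k hk.le) s ?_ ?_).le
    · exact ⟨(hmem k hk.le).1.trans hs.1.le, hs.2.trans (hmem (k + 1) hk).2⟩
    · rw [dist_comm, Real.dist_eq, abs_of_nonneg (sub_nonneg.2 hs.1.le)]
      linarith [hs.2, hstep k]
  have hle : ‖leftRiemannSum g x t n - ∫ s in (0 : ℝ)..t, g s • x s‖ ≤ C * (ε / (C + 1)) := by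
    rw [e1, leftRiemannSum, ← Finset.sum_sub_distrib]
    refine (norm_sum_le _ _).trans ((Finset.sum_le_sum hterm).trans_eq ?_)
    rw [← Finset.sum_mul, ← e2]
  rw [dist_eq_norm]
  refine hle.trans_lt ?_
  rw [mul_div_assoc', div_lt_iff₀ (by positivity)]
  nlinarith

lemma integral_smul_mem [CompleteSpace E] {S : Submodule ℝ E} (hS : IsClosed (S : Set E))
    {g : ℝ → ℝ} {x : ℝ → E} {t : ℝ} (ht : 0 ≤ t) (hg : IntervalIntegrable g volume 0 t)
    (hx : ContinuousOn x (Icc 0 t)) (hxS : ∀ s ∈ Icc 0 t, x s ∈ S) :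
    ∫ s in (0 : ℝ)..t, g s • x s ∈ S :=
  hS.mem_of_tendsto (tendsto_leftRiemannSum ht hg hx) (Eventually.of_forall fun _ ↦
    S.sum_mem fun _ hk ↦ S.smul_mem _
      (hxS _ (mul_div_mem_Icc ht (Finset.mem_range.1 hk).le)))

/-- The integral in `L²` of a continuous curve is the pathwise integral. -/
lemma coeFn_integral_smul {α : Type*} [MeasurableSpace α] {μ : Measure α} [IsFiniteMeasure μ]
    {g : ℝ → ℝ} {t : ℝ} (ht : 0 ≤ t) (hg : IntervalIntegrable g volume 0 t)
    {z : ℝ → Lp ℝ 2 μ} (hz : ContinuousOn z (Icc 0 t)) {Z : ℝ → α → ℝ}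
    (hzZ : ∀ s ∈ Icc 0 t, z s =ᵐ[μ] Z s)
    (hZ : ∀ᵐ ω ∂μ, ContinuousOn (fun s ↦ Z s ω) (Icc 0 t)) :
    ⇑(∫ s in (0 : ℝ)..t, g s • z s) =ᵐ[μ] fun ω ↦ ∫ s in (0 : ℝ)..t, g s * Z s ω := by
  have hsum : ∀ n, ⇑(leftRiemannSum g z t n) =ᵐ[μ]
      fun ω ↦ leftRiemannSum g (fun s ↦ Z s ω) t n := by
    intro n
    have h1 : ∀ᵐ ω ∂μ, ∀ k ∈ Finset.range (n + 1),
        z (t * k / (n + 1)) ω = Z (t * k / (n + 1)) ω := by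
      refine (Finset.eventually_all _).2 fun k hk ↦ ?_
      exact hzZ _ (mul_div_mem_Icc ht (Finset.mem_range.1 hk).le)
    filter_upwards [h1, coeFn_sum_smul (Finset.range (n + 1))
      (fun k : ℕ ↦ ∫ s in (t * k / (n + 1))..(t * (k + 1 : ℕ) / (n + 1)), g s)
      (fun k : ℕ ↦ z (t * k / (n + 1)))] with ω hω h2
    rw [leftRiemannSum, h2, leftRiemannSum]
    exact Finset.sum_congr rfl fun k hk ↦ by rw [hω k hk, smul_eq_mul]
  -- The sums converge in `L²`, hence almost everywhere along a subsequence; by path continuity they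
  -- also converge for almost every `ω`. No joint measurability in `(s, ω)` is needed.
  have hm := tendstoInMeasure_of_tendsto_Lp (tendsto_leftRiemannSum ht hg hz)
  obtain ⟨ns, hns, hae⟩ := hm.exists_seq_tendsto_ae
  filter_upwards [hae, hZ, ae_all_iff.2 hsum] with ω h1 h2 h3
  refine tendsto_nhds_unique h1 ?_
  simp_rw [h3]
  exact (tendsto_leftRiemannSum ht hg h2).comp hns.tendsto_atTop

end RiemannSum

/-- For `s ≤ t`, expanding the square gives `‖x s - x t‖² = v t - v s`. -/
lemma continuousOn_of_inner_eq {E : Type*} [NormedAddCommGroup E] [InnerProductSpace ℝ E] {T : ℝ}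
    {v : ℝ → ℝ} {x : ℝ → E} (hv : ContinuousOn v (Icc 0 T))
    (h : ∀ s ∈ Icc 0 T, ∀ t ∈ Icc 0 T, s ≤ t → inner ℝ (x s) (x t) = v s) :
    ContinuousOn x (Icc 0 T) := by
  have key : ∀ s ∈ Icc 0 T, ∀ t ∈ Icc 0 T, ‖x s - x t‖ ^ 2 ≤ |v s - v t| := by
    intro s hs t ht
    wlog hst : s ≤ t generalizing s t
    · rw [norm_sub_rev, abs_sub_comm]
      exact this t ht s hs (not_le.1 hst).le
    rw [norm_sub_sq_real, h s hs t ht hst, ← real_inner_self_eq_norm_sq,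
      ← real_inner_self_eq_norm_sq, h s hs s hs le_rfl, h t ht t ht le_rfl, abs_sub_comm]
    refine le_trans (le_of_eq ?_) (le_abs_self _)
    ring
  intro t ht
  refine tendsto_iff_norm_sub_tendsto_zero.2 ?_
  have h1 : Tendsto (fun s ↦ √|v s - v t|) (𝓝[Icc 0 T] t) (𝓝 0) := by
    have : Tendsto (fun s ↦ v s - v t) (𝓝[Icc 0 T] t) (𝓝 (v t - v t)) :=
      (hv t ht).tendsto.sub_const _
    simpa using this.abs.sqrt
  refine squeeze_zero' (Eventually.of_forall fun s ↦ norm_nonneg _) ?_ h1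
  filter_upwards [self_mem_nhdsWithin] with s hs
  exact Real.le_sqrt_of_sq_le (key s hs t ht)

/-! ### Closed forms of the covariance integrals -/

namespace IsBridgeRate

variable {T : ℝ} {h : ℝ → ℝ}

/-- The primitive of the integrating factor. -/
noncomputable def factorPrimitive (h : ℝ → ℝ) (t : ℝ) : ℝ := ∫ s in (0 : ℝ)..t, factor h s

lemma intervalIntegrable_factor (H : IsBridgeRate T h) {t : ℝ} (ht : t ∈ Ico 0 T) :
    IntervalIntegrable (factor h) volume 0 t :=
  ContinuousOn.intervalIntegrable (by rw [uIcc_of_le ht.1]; exact H.continuousOn_factor ht)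

lemma continuousOn_factorPrimitive (H : IsBridgeRate T h) {t : ℝ} (ht : t ∈ Ico 0 T) :
    ContinuousOn (factorPrimitive h) (Icc 0 t) :=
  continuousOn_primitive ht.1 (H.intervalIntegrable_factor ht)

lemma factorPrimitive_zero : factorPrimitive h 0 = 0 := by simp [factorPrimitive]

lemma hasDerivAt_factorPrimitive (H : IsBridgeRate T h) {t : ℝ} (ht : t ∈ Ioo 0 T) :
    HasDerivAt (factorPrimitive h) (factor h t) t :=
  hasDerivAt_integral ht (fun _ hs ↦ H.intervalIntegrable_factor hs)
    (H.hasDerivAt_factor ht).continuousAt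

lemma integral_weight_mul_id (H : IsBridgeRate T h) {t : ℝ} (ht : t ∈ Ico 0 T) :
    ∫ r in (0 : ℝ)..t, weight h r * r = t * factor h t - factorPrimitive h t := by
  rw [integral_eq_sub (F := fun r ↦ r * factor h r - factorPrimitive h r) ht.1]
  · simp [factorPrimitive_zero]
  · exact (continuousOn_id.mul (H.continuousOn_factor ht)).sub (H.continuousOn_factorPrimitive ht)
  · intro r hr
    have hr' : r ∈ Ioo 0 T := ⟨hr.1, hr.2.trans ht.2⟩
    exact (((hasDerivAt_id r).mul (H.hasDerivAt_factor hr')).sub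
      (H.hasDerivAt_factorPrimitive hr')).congr_deriv (by simp only [id]; ring)
  · exact H.intervalIntegrable_weight_mul ht continuousOn_id

lemma integral_weight_mul_add_id (H : IsBridgeRate T h) {t : ℝ} (ht : t ∈ Ico 0 T) :
    ∫ r in (0 : ℝ)..t, weight h r * (h r + r) = t * factor h t := by
  rw [integral_eq_sub (F := fun r ↦ r * factor h r) ht.1]
  · simp
  · exact continuousOn_id.mul (H.continuousOn_factor ht)
  · intro r hr
    have hr' : r ∈ Ioo 0 T := ⟨hr.1, hr.2.trans ht.2⟩
    refine ((hasDerivAt_id r).mul (H.hasDerivAt_factor hr')).congr_deriv ?_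
    rw [mul_add, H.weight_mul hr']
    simp only [id]
    ring
  · exact H.intervalIntegrable_weight_mul ht (H.cont.add continuousOn_id)

/-- The right-hand side, as a function of `s`, is an antiderivative vanishing at `0`; `ψ' h = ψ` is
what makes it work. For `s ≤ t` it is the covariance of the weighted integrals up to `s` and `t`. -/
lemma integral_weight_mul_cov (H : IsBridgeRate T h) {s t : ℝ} (hs : s ∈ Ico 0 T) :
    ∫ r in (0 : ℝ)..s, weight h r *
      (2 * r * factor h r - factorPrimitive h r + (h r + r + r) * (factor h t - factor h r)) =
    2 * factor h s * (s * factor h s - factorPrimitive h s) +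
      (factor h t - factor h s) * (2 * s * factor h s - factorPrimitive h s) := by
  have hc := H.continuousOn_factor hs
  have hp := H.continuousOn_factorPrimitive hs
  rw [integral_eq_sub (F := fun r ↦ 2 * factor h r * (r * factor h r - factorPrimitive h r) +
      (factor h t - factor h r) * (2 * r * factor h r - factorPrimitive h r)) hs.1]
  · simp [factorPrimitive_zero]
  · fun_prop
  · intro r hr
    have hr' : r ∈ Ioo 0 T := ⟨hr.1, hr.2.trans hs.2⟩
    have hf := H.hasDerivAt_factor hr'
    have hP := H.hasDerivAt_factorPrimitive hr'
    have hid := hasDerivAt_id r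
    have := ((hf.const_mul 2).mul ((hid.mul hf).sub hP)).add
      ((hf.const_sub (factor h t)).mul (((hid.const_mul 2).mul hf).sub hP))
    refine this.congr_deriv ?_
    have hw := H.weight_mul hr'
    simp only [id, Pi.mul_apply, Pi.sub_apply]
    linear_combination (-(factor h t - factor h r)) * hw
  · refine (H.intervalIntegrable_weight hs).mul_continuousOn ?_
    rw [uIcc_of_le hs.1]
    have hh : ContinuousOn h (Icc 0 s) := H.cont.mono (Icc_subset_Icc_right hs.2.le)
    fun_prop

end IsBridgeRate

/-! ### Covariances of the solution in `L²(P)` -/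

namespace IsWienerPair

variable {Ω : Type*} [MeasurableSpace Ω] {P : Measure Ω} {T : ℝ} {v : ℝ → ℝ}
  {S : Submodule ℝ (Lp ℝ 2 P)} {w x : ℝ → Lp ℝ 2 P}

open IsBridgeRate

/-- The integral of `weight • (x - w)` in `L²(P)`. -/
noncomputable def weightedIntegral (v : ℝ → ℝ) (w x : ℝ → Lp ℝ 2 P) (t : ℝ) : Lp ℝ 2 P :=
  ∫ r in (0 : ℝ)..t, weight (fun s ↦ v s - s) r • (x r - w r)

/-- The solution in `L²(P)` of the equation at times `t < T`. -/
noncomputable def solution (v : ℝ → ℝ) (w x : ℝ → Lp ℝ 2 P) (t : ℝ) : Lp ℝ 2 P :=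
  w t + (factor (fun s ↦ v s - s) t)⁻¹ • weightedIntegral v w x t

lemma continuousOn_left (hp : IsWienerPair P T v S w x) : ContinuousOn w (Icc 0 T) :=
  continuousOn_of_inner_eq continuousOn_id hp.inner_left

lemma continuousOn_right (hp : IsWienerPair P T v S w x) (hv : ContinuousOn v (Icc 0 T)) :
    ContinuousOn x (Icc 0 T) :=
  continuousOn_of_inner_eq hv hp.inner_right

lemma continuousOn_of_isBridgeRate (H : IsBridgeRate T (fun s ↦ v s - s)) :
    ContinuousOn v (Icc 0 T) := by
  exact (H.cont.add continuousOn_id).congr fun s _ ↦ by simp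

lemma continuousOn_sub (hp : IsWienerPair P T v S w x) (H : IsBridgeRate T (fun s ↦ v s - s)) :
    ContinuousOn (fun r ↦ x r - w r) (Icc 0 T) :=
  (hp.continuousOn_right (continuousOn_of_isBridgeRate H)).sub hp.continuousOn_left

lemma inner_weightedIntegral (hp : IsWienerPair P T v S w x)
    (H : IsBridgeRate T (fun s ↦ v s - s)) {t : ℝ} (ht : t ∈ Ico 0 T) (z : Lp ℝ 2 P) :
    inner ℝ z (weightedIntegral v w x t) =
      ∫ r in (0 : ℝ)..t, weight (fun s ↦ v s - s) r * inner ℝ z (x r - w r) := by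
  have hi := H.intervalIntegrable_weight_smul ht (hp.continuousOn_sub H)
  have := (innerSL ℝ z).intervalIntegral_comp_comm hi
  simp only [innerSL_apply_apply, inner_smul_right] at this
  exact this.symm

variable (hp : IsWienerPair P T v S w x) (H : IsBridgeRate T (fun s ↦ v s - s))
include hp

lemma inner_left_sub {s r : ℝ} (hs : s ∈ Icc 0 T) (hr : r ∈ Icc 0 T) :
    inner ℝ (w s) (x r - w r) = - min s r := by
  rw [inner_sub_right, hp.inner_left_right s hs r hr, zero_sub, neg_inj]
  rcases le_total s r with h | h
  · rw [hp.inner_left s hs r hr h, min_eq_left h]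
  · rw [real_inner_comm, hp.inner_left r hr s hs h, min_eq_right h]

lemma inner_sub_sub {s r : ℝ} (hs : s ∈ Icc 0 T) (hr : r ∈ Icc 0 T) (hsr : s ≤ r) :
    inner ℝ (x s - w s) (x r - w r) = v s + s := by
  rw [inner_sub_left, hp.inner_left_sub hs hr, min_eq_left hsr, inner_sub_right,
    hp.inner_right s hs r hr hsr, real_inner_comm, hp.inner_left_right r hr s hs]
  ring

lemma inner_right_sub {s r : ℝ} (hs : s ∈ Icc 0 T) (hr : r ∈ Icc 0 T) (hsr : s ≤ r) :
    inner ℝ (x r) (x s - w s) = v s := by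
  rw [inner_sub_right, real_inner_comm (w s), hp.inner_left_right s hs r hr, real_inner_comm,
    hp.inner_right s hs r hr hsr, sub_zero]

include H

/-- Splitting of a weighted integral with an integrand that is constant after time `r`. -/
lemma integral_weight_mul_eq {r t : ℝ} (hr : r ∈ Ico 0 T) (ht : t ∈ Ico 0 T) (hrt : r ≤ t)
    {z : Lp ℝ 2 P} {f : ℝ → ℝ} {c : ℝ}
    (h1 : ∀ q ∈ Icc 0 r, inner ℝ z (x q - w q) = f q)
    (h2 : ∀ q ∈ Icc r t, inner ℝ z (x q - w q) = c) :
    inner ℝ z (weightedIntegral v w x t) =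
      (∫ q in (0 : ℝ)..r, weight (fun s ↦ v s - s) q * f q) +
        (factor (fun s ↦ v s - s) t - factor (fun s ↦ v s - s) r) * c := by
  have e1 : ∫ q in (0 : ℝ)..r, weight (fun s ↦ v s - s) q * inner ℝ z (x q - w q) =
      ∫ q in (0 : ℝ)..r, weight (fun s ↦ v s - s) q * f q := by
    refine intervalIntegral.integral_congr fun q hq ↦ ?_
    rw [uIcc_of_le hr.1] at hq
    simp only [h1 q hq]
  have e2 : ∫ q in r..t, weight (fun s ↦ v s - s) q * inner ℝ z (x q - w q) =
      (factor (fun s ↦ v s - s) t - factor (fun s ↦ v s - s) r) * c := by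
    rw [← H.integral_weight hr ht, ← intervalIntegral.integral_mul_const]
    refine intervalIntegral.integral_congr fun q hq ↦ ?_
    rw [uIcc_of_le hrt] at hq
    simp only [h2 q hq]
  have hc : ContinuousOn (fun q ↦ inner ℝ z (x q - w q)) (Icc 0 T) :=
    continuousOn_const.inner (hp.continuousOn_sub H)
  have hi := fun s hs ↦ H.intervalIntegrable_weight_mul (t := s) hs hc
  rw [hp.inner_weightedIntegral H ht, ← e1, ← e2,
    intervalIntegral.integral_add_adjacent_intervals (hi r hr) ((hi r hr).symm.trans (hi t ht))]

lemma inner_left_weightedIntegral {s t : ℝ} (hs : s ∈ Ico 0 T) (ht : t ∈ Ico 0 T) (hst : s ≤ t) :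
    inner ℝ (w s) (weightedIntegral v w x t) =
      factorPrimitive (fun s ↦ v s - s) s - s * factor (fun s ↦ v s - s) t := by
  have hs' := Ico_subset_Icc_self hs
  rw [hp.integral_weight_mul_eq H hs ht hst (f := fun q ↦ -q) (c := -s)
    (fun q hq ↦ by rw [hp.inner_left_sub hs' ⟨hq.1, hq.2.trans hs'.2⟩, min_eq_right hq.2])
    (fun q hq ↦ by
      rw [hp.inner_left_sub hs' ⟨hs'.1.trans hq.1, hq.2.trans ht.2.le⟩, min_eq_left hq.1])]
  simp_rw [mul_neg]
  rw [intervalIntegral.integral_neg, H.integral_weight_mul_id hs]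
  ring

lemma inner_left_weightedIntegral_of_ge {s t : ℝ} (hs : s ∈ Icc 0 T) (ht : t ∈ Ico 0 T)
    (hts : t ≤ s) :
    inner ℝ (w s) (weightedIntegral v w x t) =
      factorPrimitive (fun s ↦ v s - s) t - t * factor (fun s ↦ v s - s) t := by
  rw [hp.integral_weight_mul_eq H ht ht le_rfl (f := fun q ↦ -q) (c := -t)
    (fun q hq ↦ by
      rw [hp.inner_left_sub hs ⟨hq.1, hq.2.trans ht.2.le⟩, min_eq_right (hq.2.trans hts)])
    (fun q hq ↦ by
      obtain rfl : q = t := le_antisymm hq.2 hq.1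
      rw [hp.inner_left_sub hs ⟨ht.1, ht.2.le⟩, min_eq_right hts])]
  simp_rw [mul_neg]
  rw [intervalIntegral.integral_neg, H.integral_weight_mul_id ht]
  ring

lemma inner_sub_weightedIntegral {r t : ℝ} (hr : r ∈ Ico 0 T) (ht : t ∈ Ico 0 T) (hrt : r ≤ t) :
    inner ℝ (x r - w r) (weightedIntegral v w x t) =
      2 * r * factor (fun s ↦ v s - s) r - factorPrimitive (fun s ↦ v s - s) r +
        ((v r - r) + r + r) * (factor (fun s ↦ v s - s) t - factor (fun s ↦ v s - s) r) := by
  have hr' := Ico_subset_Icc_self hr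
  rw [hp.integral_weight_mul_eq H hr ht hrt (f := fun q ↦ (v q - q + q) + q) (c := v r + r)
    (fun q hq ↦ by
      rw [real_inner_comm, hp.inner_sub_sub ⟨hq.1, hq.2.trans hr'.2⟩ hr' hq.2]
      ring)
    (fun q hq ↦ hp.inner_sub_sub hr' ⟨hr.1.trans hq.1, hq.2.trans ht.2.le⟩ hq.1)]
  have e : ∫ q in (0 : ℝ)..r, weight (fun s ↦ v s - s) q * ((v q - q + q) + q) =
      (∫ q in (0 : ℝ)..r, weight (fun s ↦ v s - s) q * (v q - q + q)) +
        ∫ q in (0 : ℝ)..r, weight (fun s ↦ v s - s) q * q := by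
    simp_rw [mul_add _ (_ + _)]
    exact intervalIntegral.integral_add
      (H.intervalIntegrable_weight_mul hr (H.cont.add continuousOn_id))
      (H.intervalIntegrable_weight_mul hr continuousOn_id)
  rw [e, H.integral_weight_mul_add_id hr, H.integral_weight_mul_id hr]
  ring

lemma inner_weightedIntegral_weightedIntegral {s t : ℝ} (hs : s ∈ Ico 0 T) (ht : t ∈ Ico 0 T)
    (hst : s ≤ t) :
    inner ℝ (weightedIntegral v w x s) (weightedIntegral v w x t) =
      2 * factor (fun s ↦ v s - s) s * (s * factor (fun s ↦ v s - s) s -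
        factorPrimitive (fun s ↦ v s - s) s) +
      (factor (fun s ↦ v s - s) t - factor (fun s ↦ v s - s) s) *
        (2 * s * factor (fun s ↦ v s - s) s - factorPrimitive (fun s ↦ v s - s) s) := by
  rw [real_inner_comm, hp.inner_weightedIntegral H hs, ← H.integral_weight_mul_cov hs]
  refine intervalIntegral.integral_congr fun r hr ↦ ?_
  rw [uIcc_of_le hs.1] at hr
  rw [real_inner_comm, hp.inner_sub_weightedIntegral H ⟨hr.1, hr.2.trans_lt hs.2⟩ ht
    (hr.2.trans hst)]

/-- The solution has the covariance of a Brownian motion. -/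
lemma inner_solution_solution {s t : ℝ} (hs : s ∈ Ico 0 T) (ht : t ∈ Ico 0 T) (hst : s ≤ t) :
    inner ℝ (solution v w x s) (solution v w x t) = s := by
  have h1 := (factor_pos (h := fun s ↦ v s - s) s).ne'
  have h2 := (factor_pos (h := fun s ↦ v s - s) t).ne'
  simp only [solution, inner_add_left, inner_add_right, inner_smul_right, inner_smul_left,
    conj_trivial]
  rw [real_inner_comm (w t) (weightedIntegral v w x s), hp.inner_left s (Ico_subset_Icc_self hs) t (Ico_subset_Icc_self ht) hst,
    hp.inner_left_weightedIntegral H hs ht hst,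
    hp.inner_left_weightedIntegral_of_ge H (Ico_subset_Icc_self ht) hs hst,
    hp.inner_weightedIntegral_weightedIntegral H hs ht hst]
  -- With `J` the weighted integral and `E W_s W_t = s`, the cross terms `E W_s J_t / ψ t` and `E
  -- W_t J_s / ψ s` are `Ψ s / ψ t - s` and `Ψ s / ψ s - s`, while `E J_s J_t / (ψ s ψ t) = 2 s - Ψ
  -- s / ψ s - Ψ s / ψ t`. The sum is `s`.
  field_simp
  ring

/-- Since `x T` is orthogonal to `w` and has inner product `v q` with `x q`, the claim reduces to
`∫₀ᵗ ψ' v = t ψ t`. -/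
lemma inner_solution_right (hT : 0 < T) {t : ℝ} (ht : t ∈ Ico 0 T) :
    inner ℝ (solution v w x t) (x T) = t := by
  have h2 := (factor_pos (h := fun s ↦ v s - s) t).ne'
  have ht' := Ico_subset_Icc_self ht
  have hTT : T ∈ Icc 0 T := ⟨hT.le, le_rfl⟩
  rw [solution, inner_add_left, hp.inner_left_right t ht' T hTT, inner_smul_left, conj_trivial,
    real_inner_comm, hp.integral_weight_mul_eq H ht ht le_rfl (f := fun q ↦ (v q - q) + q) (c := v t)
    (fun q hq ↦ by
      rw [hp.inner_right_sub ⟨hq.1, hq.2.trans ht.2.le⟩ hTT (hq.2.trans ht.2.le)]; ring)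
    (fun q hq ↦ by
      obtain rfl : q = t := le_antisymm hq.2 hq.1
      rw [hp.inner_right_sub ht' hTT ht.2.le]),
    H.integral_weight_mul_add_id ht]
  field_simp
  ring

lemma solution_mem {t : ℝ} (ht : t ∈ Ico 0 T) : solution v w x t ∈ S := by
  have hsub : Icc 0 t ⊆ Icc 0 T := Icc_subset_Icc_right ht.2.le
  refine S.add_mem (hp.left_mem t (Ico_subset_Icc_self ht)) (S.smul_mem _ ?_)
  exact integral_smul_mem hp.isClosed ht.1 (H.intervalIntegrable_weight ht)
    ((hp.continuousOn_sub H).mono hsub)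
    fun s hs ↦ S.sub_mem (hp.right_mem s (hsub hs)) (hp.left_mem s (hsub hs))

lemma coeFn_solution [IsFiniteMeasure P] {W V : ℝ → Ω → ℝ} (hw : ∀ t ∈ Icc 0 T, w t =ᵐ[P] W t)
    (hx : ∀ t ∈ Icc 0 T, x t =ᵐ[P] V t) (hW : ∀ᵐ ω ∂P, ContinuousOn (fun t ↦ W t ω) (Icc 0 T))
    (hV : ∀ᵐ ω ∂P, ContinuousOn (fun t ↦ V t ω) (Icc 0 T)) {t : ℝ} (ht : t ∈ Ico 0 T) :
    ⇑(solution v w x t) =ᵐ[P] fun ω ↦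
      W t ω + IsBridgeRate.average (fun s ↦ v s - s) (fun s ↦ V s ω - W s ω) t := by
  have hsub : Icc 0 t ⊆ Icc 0 T := Icc_subset_Icc_right ht.2.le
  have hI := coeFn_integral_smul (Z := fun s ω ↦ V s ω - W s ω) ht.1
    (H.intervalIntegrable_weight ht) ((hp.continuousOn_sub H).mono hsub)
    (fun s hs ↦ by
      filter_upwards [hx s (hsub hs), hw s (hsub hs), Lp.coeFn_sub (x s) (w s)] with ω h1 h2 h3
      rw [h3, Pi.sub_apply, h1, h2])
    (by filter_upwards [hW, hV] with ω h1 h2 using (h2.sub h1).mono hsub)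
  filter_upwards [hI, hw t (Ico_subset_Icc_self ht),
    Lp.coeFn_add (w t) ((factor (fun s ↦ v s - s) t)⁻¹ • weightedIntegral v w x t),
    Lp.coeFn_smul (factor (fun s ↦ v s - s) t)⁻¹ (weightedIntegral v w x t)] with ω h1 h2 h3 h4
  rw [solution, h3, Pi.add_apply, h2, h4, Pi.smul_apply, weightedIntegral, h1, IsBridgeRate.average, smul_eq_mul]

end IsWienerPair

/-- As `v` is a constant plus a primitive of `σ² ≥ 0`, it is continuous and nondecreasing, which is
the one-sided bound on the increments of `h`. -/
lemma isBridgeRate_of_integral_sq {T : ℝ} (hT : 0 < T) {v σ : ℝ → ℝ} {v₀ : NNReal}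
    (hσ : MemLp σ 2 (volume.restrict (Ioc 0 T)))
    (hv : ∀ t ∈ Icc 0 T, v t = v₀ + ∫ r in (0 : ℝ)..t, σ r ^ 2) (hvT : v T = T)
    (hint : ∀ t ∈ Ico 0 T, ∫⁻ s in Ioc 0 t, ‖v s - s‖ₑ⁻¹ < ⊤) :
    IsBridgeRate T (fun s ↦ v s - s) := by
  have hi : IntervalIntegrable (fun r ↦ σ r ^ 2) volume 0 T :=
    (intervalIntegrable_iff_integrableOn_Ioc_of_le hT.le).2 hσ.integrable_sq
  have hi' : ∀ t ∈ Icc 0 T, IntervalIntegrable (fun r ↦ σ r ^ 2) volume 0 t := fun t ht ↦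
    hi.mono_set (by rw [uIcc_of_le ht.1, uIcc_of_le hT.le]; exact Icc_subset_Icc_right ht.2)
  have hc : ContinuousOn v (Icc 0 T) :=
    (continuousOn_const.add (IsBridgeRate.continuousOn_primitive hT.le hi)).congr hv
  refine isBridgeRate_of_monotone hT (hc.sub continuousOn_id) (fun s hs t ht hst ↦ ?_) ?_
    (by simp [hvT]) hint
  · have h1 := intervalIntegral.integral_add_adjacent_intervals (hi' s hs)
      ((hi' s hs).symm.trans (hi' t ht))
    have h2 : 0 ≤ ∫ r in s..t, σ r ^ 2 :=
      intervalIntegral.integral_nonneg hst fun _ _ ↦ sq_nonneg _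
    have := hv s hs
    have := hv t ht
    linarith
  · have := hv 0 ⟨le_rfl, hT.le⟩
    simp [this]

/-! ### The law of the solution and the main theorem -/

namespace IsWienerPair

variable {Ω : Type*} [MeasurableSpace Ω] {P : Measure Ω} [IsProbabilityMeasure P] {T : ℝ}
  {v : ℝ → ℝ} {S : Submodule ℝ (Lp ℝ 2 P)} {w x : ℝ → Lp ℝ 2 P} {W V B : ℝ → Ω → ℝ}

/-- The solution of the bridge equation is a Brownian motion. -/
lemma isBrownianOn (hp : IsWienerPair P T v S w x) (H : IsBridgeRate T (fun s ↦ v s - s))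
    (hw : ∀ t ∈ Icc 0 T, w t =ᵐ[P] W t) (hx : ∀ t ∈ Icc 0 T, x t =ᵐ[P] V t)
    (hW : ∀ᵐ ω ∂P, ContinuousOn (fun t ↦ W t ω) (Icc 0 T))
    (hV : ∀ᵐ ω ∂P, ContinuousOn (fun t ↦ V t ω) (Icc 0 T)) (hvT : v T = T)
    (hB : ∀ᵐ ω ∂P, IsSolutionPath T v (fun s ↦ V s ω) (fun s ↦ W s ω) (fun s ↦ B s ω)) :
    IsBrownianOn P T B := by
  have hTT : T ∈ Icc 0 T := ⟨H.pos_T.le, le_rfl⟩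
  refine ⟨fun I hI ↦ ?_, ?_⟩
  · set Y : I → Lp ℝ 2 P := fun t ↦ if ((t : NNReal) : ℝ) < T then solution v w x (t : NNReal) else x T
    have hYB : ∀ t : I, Y t =ᵐ[P] B (t : NNReal) := by
      intro t
      rcases lt_or_ge ((t : NNReal) : ℝ) T with ht | ht
      · have ht' : ((t : NNReal) : ℝ) ∈ Ico 0 T := ⟨NNReal.coe_nonneg _, ht⟩
        simp only [Y, if_pos ht]
        filter_upwards [hp.coeFn_solution H hw hx hW hV ht', hB, hW, hV] with ω h1 h2 h3 h4
        rw [h1, ((H.isSolutionPath_iff h4 h3).1 h2).1 _ ht']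
      · have ht' : ((t : NNReal) : ℝ) = T := le_antisymm (hI t t.2) ht
        simp only [Y, if_neg ht.not_gt, ht']
        filter_upwards [hx T hTT, hB, hW, hV] with ω h1 h2 h3 h4
        rw [h1, ((H.isSolutionPath_iff h4 h3).1 h2).2]
    have hlaw := hp.isGaussianSpace.hasLaw_projectiveFamily I (Y := Y) (fun t ↦ ?_) fun s t hst ↦ ?_
    · refine hlaw.congr ?_
      filter_upwards [ae_all_iff.2 hYB] with ω hω
      exact funext fun t ↦ (hω t).symm
    · rcases lt_or_ge ((t : NNReal) : ℝ) T with ht | ht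
      · simp only [Y, if_pos ht]
        exact hp.solution_mem H ⟨NNReal.coe_nonneg _, ht⟩
      · simp only [Y, if_neg ht.not_gt]
        exact hp.right_mem T hTT
    · have hst' : ((s : NNReal) : ℝ) ≤ (t : NNReal) := NNReal.coe_le_coe.2 hst
      rcases lt_or_ge ((s : NNReal) : ℝ) T with hs | hs
      · rcases lt_or_ge ((t : NNReal) : ℝ) T with ht | ht
        · simp only [Y, if_pos ht, if_pos hs]
          exact hp.inner_solution_solution H ⟨NNReal.coe_nonneg _, hs⟩ ⟨NNReal.coe_nonneg _, ht⟩ hst'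
        · simp only [Y, if_neg ht.not_gt, if_pos hs]
          exact hp.inner_solution_right H H.pos_T ⟨NNReal.coe_nonneg _, hs⟩
      · simp only [Y, if_neg (hs.trans hst').not_gt, if_neg hs.not_gt]
        rw [hp.inner_right T hTT T hTT le_rfl, hvT]
        exact le_antisymm hs (hI s s.2)
  · filter_upwards [hB, hW, hV] with ω h1 h2 h3 using H.continuousOn_of_isSolutionPath h3 h2 h1

end IsWienerPair

theorem mainTheorem4 {Ω : Type*} [MeasurableSpace Ω] (P : Measure Ω) [IsProbabilityMeasure P]
    (T : ℝ) (hT : 0 < T) (W₁ W₂ V : ℝ → Ω → ℝ) (σ : ℝ → ℝ) (v₀ : NNReal)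
    -- `(W₁, W₂)` is a two-dimensional Brownian motion on `[0, T]`, independent of `V₀`
    (hW₁ : IsBrownianOn P T W₁) (hW₂ : IsBrownianOn P T W₂)
    (hW : IndepFun (fun ω (t : Icc (0 : ℝ) T) ↦ W₁ t ω) (fun ω (t : Icc (0 : ℝ) T) ↦ W₂ t ω) P)
    (hWV : IndepFun (fun ω (t : Icc (0 : ℝ) T) ↦ (W₁ t ω, W₂ t ω)) (V 0) P)
    -- `V₀` is centred normal and `V_t = V₀ + ∫₀ᵗ σ_s dW₁_s`, with continuous paths
    (hV₀ : HasLaw (V 0) (gaussianReal 0 v₀) P)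
    (hσ : MemLp σ 2 (volume.restrict (Ioc 0 T)))
    (hV : ∀ t ∈ Icc 0 T, IsWienerIntegral P W₁ σ t (fun ω ↦ V t ω - V 0 ω))
    (hVc : ∀ᵐ ω ∂P, ContinuousOn (fun t ↦ V t ω) (Icc 0 T))
    (hVT : Var[V T; P] = T)
    -- integrability of `1 / (Var(V_s) - s)` on `[0, t]`, with `1 / 0 = ∞`
    (hint : ∀ t ∈ Ico 0 T, ∫⁻ s in Ioc 0 t, ‖Var[V s; P] - s‖ₑ⁻¹ < ⊤) :
    (∃ B : ℝ → Ω → ℝ, IsSolution P T V W₂ B) ∧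
    (∀ B B' : ℝ → Ω → ℝ, IsSolution P T V W₂ B → IsSolution P T V W₂ B' →
      ∀ᵐ ω ∂P, ∀ t ∈ Icc 0 T, B t ω = B' t ω) ∧
    (∀ B : ℝ → Ω → ℝ, IsSolution P T V W₂ B →
      IsBrownianOn P T B ∧ B T =ᵐ[P] V T) := by
  obtain ⟨⟨S, w, x, hp, hw, hx⟩, hvar⟩ := exists_isWienerPair hW₁ hW₂ hW hWV hV₀ hσ hV
  have H := isBridgeRate_of_integral_sq hT hσ hvar hVT hint
  refine ⟨⟨fun t ω ↦ if t < T then W₂ t ω + IsBridgeRate.average (fun s ↦ Var[V s; P] - s)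
    (fun s ↦ V s ω - W₂ s ω) t else V t ω, ?_⟩, fun B B' hB hB' ↦ ?_, fun B hB ↦ ⟨?_, ?_⟩⟩
  · filter_upwards [hW₂.cont, hVc] with ω h1 h2
    exact (H.isSolutionPath_iff h2 h1).2 ⟨fun t ht ↦ if_pos ht.2, if_neg (lt_irrefl T)⟩
  · filter_upwards [hB, hB', hW₂.cont, hVc] with ω h1 h2 h3 h4 t ht
    rw [H.isSolutionPath_iff h4 h3] at h1 h2
    rcases ht.2.lt_or_eq with htT | rfl
    · exact (h1.1 t ⟨ht.1, htT⟩).trans (h2.1 t ⟨ht.1, htT⟩).symm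
    · exact h1.2.trans h2.2.symm
  · exact hp.isBrownianOn H hw hx hW₂.cont hVc hVT hB
  · filter_upwards [hB, hW₂.cont, hVc] with ω h1 h2 h3
    exact ((H.isSolutionPath_iff h3 h2).1 h1).2
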